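/- **Setting.** Let $T>0$, $\alpha>0$, $\mu\in\mathbb R$, and let $\mathcal M([0,T])$ be the space of finite signed Radon measures on $[0,T]$, with the total variation norm $\|\cdot\|_{\mathcal M}$ and with weak-$*$ convergence as the dual of $C([0,T])$. A function used as a measure stands for the measure with that density with respect to Lebesgue measure. Let $B$ be the set of measures $\hat e=\sum_{i=1}^\infty\delta_{(\tau_i,\lambda_i)}$ with $\tau_i\in[0,T]$, $\lambda_i\in[0,\infty)$ and $\hat e([0,T]\times[0,\lambda])<\infty$ for all $\lambda\ge0$, with the $\sigma$-algebra generated by the maps $\hat e\mapsto\hat e(S)$, $S$ Borel. Let $P$ be a probability measure on $B$ under which the support $\operatorname{spt}\hat e$ is a Poisson point process on $[0,T]\times[0,\infty)$ with intensity $1$. For $\lambda:[0,T]\to[0,\infty)$ put $$\hat e_\lambda=\sum_{(\tau,y)\in\operatorname{spt}\hat e,\ y\le\lambda(\tau)}\delta_\tau .$$ Let $r=(r(t))_{t\in[0,T]}$ be Gaussian white noise, i.e. a family of independent standard normal random variables, independent of $\hat e$. Let $\lambda^n$ ($n\in\mathbb N$) and $\lambda^\infty$ be measurable, integrable functions $[0,T]\to[0,\infty)$,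 and let $\sigma^n\ge0$. For every $n$ let $0=t_0^n<\dots<t_{N^n}^n=T$ be a partition, such that the number $N^n$ of intervals is strictly increasing in $n$ and $\sup_i(t_i^n-t_{i-1}^n)\to0$ as $n\to\infty$. Put $e^n=\hat e_{\lambda^n}$, $e^\infty=\hat e_{\lambda^\infty}$ and, for $i=1,\dots,N^n$, $$(g_P^n)_i=e^n([t_{i-1}^n,t_i^n)),\qquad (g_G^n)_i=\mu+\sigma^n r(t_i^n),\qquad g^n=\alpha g_P^n+g_G^n ,$$ and for $t\in[t_{i-1}^n,t_i^n)$ $$\mathcal G_G^n(t)=\frac{(g_G^n)_i-\mu}{\alpha(t_i^n-t_{i-1}^n)},\qquad \mathcal G^n(t)=\frac{(g^n)_i-\mu}{\alpha(t_i^n-t_{i-1}^n)},$$ $$\tilde{\mathcal G}^n(t)=\frac{[\![(t_i^n-t_{i-1}^n)\mathcal G^n(t)]\!]-(t_i^n-t_{i-1}^n)\mathcal G^n(t)}{t_i^n-t_{i-1}^n},$$ where $[\![x]\!]$ denotes rounding of $x$ to the nearest nonnegative integer. **Claim.** The following hold almost surely with respect to the distribution of $\hat e$ and $r$ (apart from the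 second sentence of 2, which is a statement about a probability). 1. If $\lambda^n\to\lambda^\infty$ uniformly on $[0,T]$, then $e^n\to e^\infty$ strongly (in norm) in $\mathcal M([0,T])$. 2. If $\lambda^n$ and $\lambda^\infty$ belong to $L^\infty((0,T))$ and $\lambda^n\rightharpoonup\lambda^\infty$ weakly-$*$ in $L^\infty((0,T))$, then there is a subsequence (depending on the realization) along which $e^n\to e^\infty$ strongly in $\mathcal M([0,T])$. If $\lambda^n\not\to\lambda^\infty$ strongly in $L^1((0,T))$, then with positive probability $e^n\not\to e^\infty$ strongly for the entire sequence. 3. If $\sigma^nN^n/\alpha\to0$, then $\|\mathcal G_G^n\|_{\mathcal M}\to0$. If $\sigma^nN^n/\alpha\to\infty$, then $\|\mathcal G_G^n\|_{\mathcal M}\to\infty$. If $\sigma^nN^n/\alpha$ converges to a limit in $(0,\infty)$, then $\mathcal G_G^n\rightharpoonup0$ weakly-$*$ in $\mathcal M([0,T])$. 4. Let $\sigma^nN^n/\alpha$ converge to a finite limit. If $\lambda^n\to\lambda^\infty$ uniformly on $[0,T]$, then $\mathcal G^n\rightharpoonup e^\infty$ weakly-$*$ in $\mathcal M([0,T])$.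 If only $\lambda^n\rightharpoonup\lambda^\infty$ weakly-$*$ in $L^\infty((0,T))$, then $\mathcal G^n\rightharpoonup e^\infty$ weakly-$*$ along a subsequence (depending on the realization). 5. If $\sigma^nN^n/\alpha\to0$, then $\|\tilde{\mathcal G}^n\|_{\mathcal M}\to0$. -/

import Mathlib

open MeasureTheory ProbabilityTheory Set Filter Topology
open scoped NNReal ENNReal

namespace ScanLimit

noncomputable section

/-! ### Poisson point processes and the coupling -/

/-- The random set `X` of points of `E` is, under `P`, a Poisson point process with intensity
measure `m`: the number of points in a measurable set of finite intensity `m S` is Poisson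
distributed with parameter `m S`, and the numbers of points in disjoint measurable sets are
independent. -/
structure IsPoissonPointProcess {Ω E : Type*} [MeasurableSpace Ω] [MeasurableSpace E]
    (X : Ω → Set E) (m : Measure E) (P : Measure Ω) : Prop where
  measurable_count : ∀ S : Set E, MeasurableSet S → Measurable fun ω => (X ω ∩ S).encard
  map_count : ∀ S : Set E, MeasurableSet S → m S ≠ ∞ →
    P.map (fun ω => (X ω ∩ S).encard)
      = (poissonMeasure (m S).toNNReal).map (fun k : ℕ => (k : ℕ∞))
  iIndepFun_count : ∀ (k : ℕ) (S : Fin k → Set E), (∀ j, MeasurableSet (S j)) →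
    Pairwise (fun i j => Disjoint (S i) (S j)) →
    iIndepFun (fun j ω => (X ω ∩ S j).encard) P

/-- Lebesgue measure on `[0, T]`. -/
def leb (T : ℝ) : Measure (Icc (0 : ℝ) T) :=
  (volume : Measure ℝ).comap ((↑) : Icc (0 : ℝ) T → ℝ)

/-- Lebesgue measure on the strip `[0, T] × [0, ∞)`, as a measure on `[0, T] × ℝ`. -/
def stripVolume (T : ℝ) : Measure (Icc (0 : ℝ) T × ℝ) :=
  (leb T).prod (volume.restrict (Ici (0 : ℝ)))

/-- The space `B` of measures `ê = ∑ i, δ_(τ i, l i)` with `τ i ∈ [0, T]`, `l i ∈ [0, ∞)` that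
are finite on `[0, T] × [0, L]` for every `L ≥ 0`. As a subtype of the space of measures it
carries the σ-algebra generated by the maps `ê ↦ ê S`, `S` Borel measurable. -/
abbrev CountingSpace (T : ℝ) : Type :=
  {ν : Measure (Icc (0 : ℝ) T × ℝ) //
    (∃ p : ℕ → Icc (0 : ℝ) T × ℝ, (∀ i, 0 ≤ (p i).2) ∧
      ν = Measure.sum fun i => Measure.dirac (p i)) ∧
    ∀ L : ℝ, 0 ≤ L → ν (univ ×ˢ Icc 0 L) < ∞}

/-- The support of `ê ∈ B`, a set of points in `[0, T] × [0, ∞)`. -/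
def CountingSpace.spt {T : ℝ} (e : CountingSpace T) : Set (Icc (0 : ℝ) T × ℝ) :=
  (e : Measure (Icc (0 : ℝ) T × ℝ)).support

/-- The measure of electron detection events with intensity `l`: the sum of the Dirac measures
`δ_τ` over all points `(τ, y)` of the support of `ê` with `y ≤ l τ`. -/
def electronEvents {T : ℝ} (e : CountingSpace T) (l : Icc (0 : ℝ) T → ℝ) :
    Measure (Icc (0 : ℝ) T) :=
  Measure.sum fun q : {q : Icc (0 : ℝ) T × ℝ // q ∈ e.spt ∧ q.2 ≤ l q.1} =>
    Measure.dirac q.1.1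

/-- Gaussian white noise on `[0, T]`: the law on `ℝ^[0, T]` of a family of independent standard
normal random variables `r t`, `t ∈ [0, T]`. -/
def whiteNoise (T : ℝ) : Measure (Icc (0 : ℝ) T → ℝ) :=
  Measure.infinitePi fun _ => gaussianReal 0 1

/-! ### Time partitions and signals -/

/-- A partition `0 = t 0 < t 1 < ... < t N = T` of `[0, T]`. -/
structure TimePartition (T : ℝ) where
  /-- the number of intervals -/
  N : ℕ
  /-- the partition points -/
  t : Fin (N + 1) → Icc (0 : ℝ) T
  strictMono : StrictMono t
  t_zero : (t 0 : ℝ) = 0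
  t_last : (t (Fin.last N) : ℝ) = T

namespace TimePartition

variable {T : ℝ} (p : TimePartition T)

/-- The length of the `i`-th interval. -/
def gap (i : Fin p.N) : ℝ := (p.t i.succ : ℝ) - (p.t i.castSucc : ℝ)

/-- The `i`-th interval, closed on the left and open on the right. -/
def cell (i : Fin p.N) : Set (Icc (0 : ℝ) T) := Ico (p.t i.castSucc) (p.t i.succ)

/-- The largest length of an interval of the partition. -/
def mesh : ℝ := ⨆ i, p.gap i

/-- The function that is equal to `f i` on the `i`-th interval. -/
def piecewise (f : Fin p.N → Icc (0 : ℝ) T → ℝ) (s : Icc (0 : ℝ) T) : ℝ :=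
  ∑ i, (p.cell i).indicator (f i) s

/-- The electron counts `g_P` on the intervals, for the detection events `ε`. -/
def countVec (ε : Measure (Icc (0 : ℝ) T)) (i : Fin p.N) : ℝ := ε.real (p.cell i)

/-- The background noise `g_G`, with mean `μ` and standard deviation `σ`. -/
def noiseVec (μ σ : ℝ) (r : Icc (0 : ℝ) T → ℝ) (i : Fin p.N) : ℝ := μ + σ * r (p.t i.succ)

/-- The full measurement `g = α g_P + g_G`. -/
def measVec (α μ σ : ℝ) (ε : Measure (Icc (0 : ℝ) T)) (r : Icc (0 : ℝ) T → ℝ)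
    (i : Fin p.N) : ℝ :=
  α * p.countVec ε i + p.noiseVec μ σ r i

/-- The continuum version of the background noise. -/
def noiseSignal (α μ σ : ℝ) (r : Icc (0 : ℝ) T → ℝ) : Icc (0 : ℝ) T → ℝ :=
  p.piecewise fun i _ => (p.noiseVec μ σ r i - μ) / (α * p.gap i)

/-- The continuum version of the full measurement. -/
def measSignal (α μ σ : ℝ) (ε : Measure (Icc (0 : ℝ) T)) (r : Icc (0 : ℝ) T → ℝ) :
    Icc (0 : ℝ) T → ℝ :=
  p.piecewise fun i _ => (p.measVec α μ σ ε r i - μ) / (α * p.gap i)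

/-- The deviation of a signal `G`, multiplied by the lengths of the intervals, from its rounding
to the nearest nonnegative integer, divided by the lengths of the intervals. -/
def roundingDefect (G : Icc (0 : ℝ) T → ℝ) : Icc (0 : ℝ) T → ℝ :=
  p.piecewise fun i s => 1 / p.gap i * (((round (p.gap i * G s)).toNat : ℝ) - p.gap i * G s)

end TimePartition

/-! ### Convergence of measures and intensities -/

/-- The signed measure with density `G` with respect to Lebesgue measure on `[0, T]`. -/
def densityMeasure {T : ℝ} (G : Icc (0 : ℝ) T → ℝ) : SignedMeasure (Icc (0 : ℝ) T) :=
  (leb T).withDensityᵥ G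

/-- The norm of a signed Radon measure on `[0, T]`: its total variation. -/
def tvNorm {T : ℝ} (ν : SignedMeasure (Icc (0 : ℝ) T)) : ℝ≥0∞ := ν.totalVariation univ

/-- The measures `ν n` and `ν'` are finite, and `ν n` converges to `ν'` in the total variation
norm. -/
def StrongConv {T : ℝ} (ν : ℕ → Measure (Icc (0 : ℝ) T)) (ν' : Measure (Icc (0 : ℝ) T)) : Prop :=
  ∃ (_ : ∀ n, IsFiniteMeasure (ν n)) (_ : IsFiniteMeasure ν'),
    Tendsto (fun n => tvNorm ((ν n).toSignedMeasure - ν'.toSignedMeasure)) atTop (𝓝 0)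

/-- Weak-* convergence of signed Radon measures on `[0, T]`, as the dual of `C([0, T])`. -/
def WeakStarConv {T : ℝ} (ν : ℕ → SignedMeasure (Icc (0 : ℝ) T))
    (ν' : SignedMeasure (Icc (0 : ℝ) T)) : Prop :=
  ∀ φ : C(Icc (0 : ℝ) T, ℝ),
    Tendsto (fun n => ∫ᵛ s, φ s ∂<•(ν n)) atTop (𝓝 (∫ᵛ s, φ s ∂<•ν'))

/-- Weak-* convergence of a sequence of signed measures to a nonnegative measure, which is
finite. -/
def WeakStarConvTo {T : ℝ} (ν : ℕ → SignedMeasure (Icc (0 : ℝ) T))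
    (ν' : Measure (Icc (0 : ℝ) T)) : Prop :=
  ∃ _ : IsFiniteMeasure ν', WeakStarConv ν ν'.toSignedMeasure

/-- Weak-* convergence in `L^∞((0, T))`, as the dual of `L^1((0, T))`. -/
def LinftyWeakStarConv {T : ℝ} (l : ℕ → Icc (0 : ℝ) T → ℝ) (l' : Icc (0 : ℝ) T → ℝ) : Prop :=
  (∀ n, MemLp (l n) ∞ (leb T)) ∧ MemLp l' ∞ (leb T) ∧
    ∀ g : Icc (0 : ℝ) T → ℝ, Integrable g (leb T) →
      Tendsto (fun n => ∫ s, l n s * g s ∂(leb T)) atTop (𝓝 (∫ s, l' s * g s ∂(leb T)))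

/-- Strong convergence in `L^1((0, T))`. -/
def L1Conv {T : ℝ} (l : ℕ → Icc (0 : ℝ) T → ℝ) (l' : Icc (0 : ℝ) T → ℝ) : Prop :=
  Tendsto (fun n => eLpNorm (l n - l') 1 (leb T)) atTop (𝓝 0)

end

end ScanLimit

open ScanLimit

/-!
All claims about the detection events are reduced to counting points of the Poisson process in the
set `D n` between the graphs of `lam n` and `lamInf`: if `D n` contains no point, the two measures
of detection events coincide, and conversely strong convergence implies that `D n` contains no
point for large `n`, since the total variations are integers and points with the same time
coordinate cannot cancel (`StrongConv.eventually_inter_eq_empty`).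

* For uniform convergence, only finitely many points are relevant, and almost surely none of them
  lies on the graph of `lamInf` (`ae_eventually_electronEvents_eq`).
* If strong convergence holds almost surely, the void probabilities `exp (-‖lam n - lamInf‖₁)` tend
  to one, which is convergence in `L¹` (`l1Conv_of_ae_strongConv`).
* For weak-* convergence, almost surely infinitely many of the `D n` contain no point
  (`ae_frequently_electronEvents_eq`). Let `C` be a set of bounded height on which the vertical
  distance to the graph of `lamInf` is at least `ε`. The integral of `lam n - lamInf` over `C`
  tends to zero, whereas the integrand has a fixed sign and absolute value at least `ε` on the
  parts of `C ∩ D n` above and below the graph of `lamInf`; as the intensities are uniformly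
  bounded, a fixed proportion of `C` remains outside `D n` for large `n`
  (`LinftyWeakStarConv.eventually_mul_real_le`). Given the counts of a Poisson process on a finite
  partition, at most `K` points in total avoid `D n` with conditional probability at least `c ^ K`,
  where `c` is that proportion. This bound does not depend on the partition, so the event that all
  `D n` with `n ≥ n₀` are hit has probability zero
  (`IsPoissonPointProcess.ae_frequently_inter_eq_empty`).

The noise is treated by Chernoff bounds that decay exponentially in the number of intervals, which
is at least `n`, and the Borel-Cantelli lemma (`ae_eventually_sum_neg`). They show that the averages
of `|r|` over the partition points are bounded and bounded away from zero, and that averages of `r`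
against the cell means of a test function tend to zero; a countable dense set of test functions
suffices. The rounding defect in a cell is at most the absolute value of the noise in that cell,
because the detection events contribute an integer (`abs_round_toNat_sub_le`).
-/

/-! ### Densities and step functions -/

namespace ScanLimit

section Lebesgue

variable {T : ℝ}

lemma leb_apply (s : Set (Icc (0 : ℝ) T)) : leb T s = volume ((↑) '' s : Set ℝ) := by
  rw [leb, (MeasurableEmbedding.subtype_coe measurableSet_Icc).comap_apply]

instance : IsFiniteMeasure (leb T) := by
  refine ⟨?_⟩
  rw [leb_apply]
  refine (measure_mono (t := Icc 0 T) ?_).trans_lt (by simp)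
  rintro _ ⟨x, -, rfl⟩
  exact x.2

instance : NullSingletonClass (leb T) := by
  refine ⟨fun x => ?_⟩
  rw [leb_apply, image_singleton, Real.volume_singleton]

lemma leb_Ico (a b : Icc (0 : ℝ) T) : leb T (Ico a b) = ENNReal.ofReal (b - a) := by
  rw [leb_apply, ← Real.volume_Ico]
  congr 1
  ext x
  constructor
  · rintro ⟨y, hy, rfl⟩
    exact hy
  · intro hx
    exact ⟨⟨x, a.2.1.trans hx.1, hx.2.le.trans b.2.2⟩, hx, rfl⟩

end Lebesgue

section SignedMeasures

variable {T : ℝ}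

lemma tvNorm_densityMeasure {G : Icc (0 : ℝ) T → ℝ} (hG : Integrable G (leb T)) :
    tvNorm (densityMeasure G) = ∫⁻ s, ‖G s‖ₑ ∂(leb T) := by
  rw [tvNorm, SignedMeasure.totalVariation_eq_variation, densityMeasure,
    Measure.variation_withDensityᵥ hG, withDensity_apply _ MeasurableSet.univ,
    Measure.restrict_univ]

lemma integrable_continuousMap {m : Measure (Icc (0 : ℝ) T)} [IsFiniteMeasure m]
    (φ : C(Icc (0 : ℝ) T, ℝ)) : Integrable φ m :=
  Integrable.of_bound φ.continuous.aestronglyMeasurable ‖φ‖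
    (ae_of_all _ fun s => φ.norm_coe_le_norm s)

lemma integral_densityMeasure {G : Icc (0 : ℝ) T → ℝ} (hG : Integrable G (leb T))
    (hGm : Measurable G) (φ : C(Icc (0 : ℝ) T, ℝ)) :
    ∫ᵛ s, φ s ∂<•(densityMeasure G) = ∫ s, φ s * G s ∂(leb T) := by
  have h1 := isFiniteMeasure_withDensity_ofReal hG.2
  have h2 := isFiniteMeasure_withDensity_ofReal hG.neg.2
  have key : ∀ F : Icc (0 : ℝ) T → ℝ, Measurable F →
      ∫ s, φ s ∂((leb T).withDensity fun s => ENNReal.ofReal (F s))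
        = ∫ s, (max (F s) 0) * φ s ∂(leb T) := by
    intro F hF
    rw [integral_withDensity_eq_integral_toReal_smul (by fun_prop) (ae_of_all _ fun s => by simp)]
    simp [ENNReal.toReal_ofReal']
  have hi : ∀ F : Icc (0 : ℝ) T → ℝ, Integrable F (leb T) →
      Integrable (fun s => (max (F s) 0) * φ s) (leb T) := fun F hF =>
    (hF.pos_part).mul_bdd φ.continuous.aestronglyMeasurable
      (ae_of_all _ fun s => φ.norm_coe_le_norm s)
  rw [densityMeasure, withDensityᵥ_eq_withDensity_pos_part_sub_withDensity_neg_part hG,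
    VectorMeasure.integral_sub_vectorMeasure, VectorMeasure.integral_toSignedMeasure,
    VectorMeasure.integral_toSignedMeasure, key G hGm, key (fun s => -G s) hGm.neg,
    ← integral_sub (hi G hG) (hi (fun s => -G s) hG.neg)]
  · refine integral_congr_ae (ae_of_all _ fun s => ?_)
    simp only
    rcases le_total 0 (G s) with h | h
    · rw [max_eq_left h, max_eq_right (by linarith)]; ring
    · rw [max_eq_right h, max_eq_left (by linarith)]; ring
  · rw [VectorMeasure.Integrable, Measure.variation_toSignedMeasure]
    exact integrable_continuousMap φ
  · rw [VectorMeasure.Integrable, Measure.variation_toSignedMeasure]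
    exact integrable_continuousMap φ

end SignedMeasures

namespace TimePartition

variable {T : ℝ} (p : TimePartition T)

lemma gap_pos (i : Fin p.N) : 0 < p.gap i := by
  have := p.strictMono (Fin.castSucc_lt_succ (i := i))
  exact sub_pos.2 this

lemma gap_le_mesh (i : Fin p.N) : p.gap i ≤ p.mesh := le_ciSup (Finite.bddAbove_range _) i

lemma measurableSet_cell (i : Fin p.N) : MeasurableSet (p.cell i) := measurableSet_Ico

lemma leb_cell (i : Fin p.N) : leb T (p.cell i) = ENNReal.ofReal (p.gap i) := leb_Ico _ _

lemma leb_real_cell (i : Fin p.N) : (leb T).real (p.cell i) = p.gap i := by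
  rw [measureReal_def, leb_cell, ENNReal.toReal_ofReal (p.gap_pos i).le]

lemma pairwise_disjoint_cell : Pairwise (Function.onFun Disjoint p.cell) := by
  intro i j hij
  wlog h : i < j generalizing i j
  · exact (this hij.symm (lt_of_le_of_ne (not_lt.1 h) hij.symm)).symm
  refine Set.disjoint_left.2 fun s hs hs' => ?_
  have h1 : p.t i.succ ≤ p.t j.castSucc := p.strictMono.monotone (by
    simpa [Fin.le_def] using h)
  exact absurd (hs.2.trans_le (h1.trans hs'.1)) (lt_irrefl _)

/-- The cells cover `[0, T)`. -/
lemma exists_mem_cell {s : Icc (0 : ℝ) T} (hs : (s : ℝ) < T) : ∃ i, s ∈ p.cell i := by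
  by_contra! h
  have key : ∀ j : Fin (p.N + 1), p.t j ≤ s := by
    intro j
    induction j using Fin.induction with
    | zero => exact Subtype.coe_le_coe.1 (p.t_zero.trans_le s.2.1)
    | succ i ih =>
      by_contra hlt
      exact h i ⟨ih, not_le.1 hlt⟩
  have := Subtype.coe_le_coe.2 (key (Fin.last p.N))
  rw [p.t_last] at this
  linarith

lemma piecewise_of_mem {f : Fin p.N → Icc (0 : ℝ) T → ℝ} {i : Fin p.N} {s : Icc (0 : ℝ) T}
    (hs : s ∈ p.cell i) : p.piecewise f s = f i s := by
  rw [piecewise, Finset.sum_eq_single i, indicator_of_mem hs]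
  · intro j _ hj
    exact indicator_of_notMem (fun h => (p.pairwise_disjoint_cell hj).le_bot ⟨h, hs⟩) _
  · simp

lemma piecewise_of_notMem {f : Fin p.N → Icc (0 : ℝ) T → ℝ} {s : Icc (0 : ℝ) T}
    (hs : ∀ i, s ∉ p.cell i) : p.piecewise f s = 0 :=
  Finset.sum_eq_zero fun i _ => indicator_of_notMem (hs i) _

/-- The step function with value `c i` on the `i`-th interval. -/
noncomputable abbrev step (c : Fin p.N → ℝ) : Icc (0 : ℝ) T → ℝ := p.piecewise fun i _ => c i

lemma measurable_step (c : Fin p.N → ℝ) : Measurable (p.step c) :=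
  Finset.measurable_fun_sum _ fun i _ => measurable_const.indicator (p.measurableSet_cell i)

lemma integrable_step (c : Fin p.N → ℝ) : Integrable (p.step c) (leb T) :=
  integrable_finsetSum _ fun i _ => (integrable_const _).indicator (p.measurableSet_cell i)

lemma tvNorm_step (c : Fin p.N → ℝ) :
    tvNorm (densityMeasure (p.step c)) = ENNReal.ofReal (∑ i, |c i| * p.gap i) := by
  have h : ∀ s, ‖p.step c s‖ₑ = ∑ i, (p.cell i).indicator (fun _ => ENNReal.ofReal |c i|) s := by
    intro s
    by_cases hs : ∃ i, s ∈ p.cell i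
    · obtain ⟨i, hi⟩ := hs
      rw [step, p.piecewise_of_mem hi, Finset.sum_eq_single i, indicator_of_mem hi,
        Real.enorm_eq_ofReal_abs]
      · intro j _ hj
        exact indicator_of_notMem (fun h => (p.pairwise_disjoint_cell hj).le_bot ⟨h, hi⟩) _
      · simp
    · push Not at hs
      rw [step, p.piecewise_of_notMem hs, Finset.sum_eq_zero fun i _ => indicator_of_notMem (hs i) _]
      simp
  rw [tvNorm_densityMeasure (p.integrable_step c)]
  simp_rw [h]
  rw [lintegral_finsetSum _ fun i _ => measurable_const.indicator (p.measurableSet_cell i),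
    ENNReal.ofReal_sum_of_nonneg fun i _ => mul_nonneg (abs_nonneg _) (p.gap_pos i).le]
  refine Finset.sum_congr rfl fun i _ => ?_
  rw [lintegral_indicator_const (p.measurableSet_cell i), leb_cell,
    ENNReal.ofReal_mul (abs_nonneg _)]

lemma integral_step (c : Fin p.N → ℝ) (φ : C(Icc (0 : ℝ) T, ℝ)) :
    ∫ᵛ s, φ s ∂<•(densityMeasure (p.step c)) = ∑ i, c i * ∫ s in p.cell i, φ s ∂(leb T) := by
  rw [integral_densityMeasure (p.integrable_step c) (p.measurable_step c)]
  have : ∀ s, φ s * p.step c s = ∑ i, (p.cell i).indicator (fun s => c i * φ s) s := by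
    intro s
    simp only [step, piecewise, Finset.mul_sum]
    refine Finset.sum_congr rfl fun i _ => ?_
    by_cases h : s ∈ p.cell i <;> simp [h, mul_comm]
  simp_rw [this]
  rw [integral_finsetSum _ fun i _ => ((integrable_continuousMap φ).const_mul (c i)).indicator
    (p.measurableSet_cell i)]
  refine Finset.sum_congr rfl fun i _ => ?_
  rw [integral_indicator (p.measurableSet_cell i), integral_const_mul]

/-- The mean value of `φ` over the `i`-th interval. -/
noncomputable def cellMean (φ : C(Icc (0 : ℝ) T, ℝ)) (i : Fin p.N) : ℝ :=
  (p.gap i)⁻¹ * ∫ s in p.cell i, φ s ∂(leb T)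

lemma abs_cellMean_sub_le {φ : C(Icc (0 : ℝ) T, ℝ)} {i : Fin p.N} {a ε : ℝ}
    (h : ∀ s ∈ p.cell i, |φ s - a| ≤ ε) : |p.cellMean φ i - a| ≤ ε := by
  have hg := p.gap_pos i
  have h1 : p.cellMean φ i - a = (p.gap i)⁻¹ * ∫ s in p.cell i, (φ s - a) ∂(leb T) := by
    rw [integral_sub (integrable_continuousMap φ) (integrable_const _), setIntegral_const,
      p.leb_real_cell, cellMean, smul_eq_mul]
    field_simp
  have h2 : ‖∫ s in p.cell i, (φ s - a) ∂(leb T)‖ ≤ ε * (leb T).real (p.cell i) :=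
    norm_setIntegral_le_of_norm_le_const (measure_lt_top _ _) fun s hs => h s hs
  rw [h1, abs_mul, abs_inv, abs_of_pos hg, inv_mul_le_iff₀ hg, mul_comm]
  rwa [p.leb_real_cell] at h2

lemma abs_cellMean_le (φ : C(Icc (0 : ℝ) T, ℝ)) (i : Fin p.N) : |p.cellMean φ i| ≤ ‖φ‖ := by
  simpa using p.abs_cellMean_sub_le (φ := φ) (i := i) (a := 0) (ε := ‖φ‖)
    fun s _ => by simpa using φ.norm_coe_le_norm s

end TimePartition

end ScanLimit

/-! ### Signals as step functions -/

namespace ScanLimit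

namespace TimePartition

variable {T : ℝ} (p : TimePartition T)

lemma noiseSignal_eq_step (α μ σ : ℝ) (r : Icc (0 : ℝ) T → ℝ) :
    p.noiseSignal α μ σ r = p.step fun i => σ * r (p.t i.succ) / (α * p.gap i) := by
  simp [noiseSignal, noiseVec, step]

lemma measSignal_eq_step (α μ σ : ℝ) (hα : 0 < α) (ε : Measure (Icc (0 : ℝ) T))
    (r : Icc (0 : ℝ) T → ℝ) :
    p.measSignal α μ σ ε r
      = p.step fun i => (p.countVec ε i + σ * r (p.t i.succ) / α) / p.gap i := by
  unfold measSignal measVec noiseVec step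
  congr 1
  funext i _
  have := p.gap_pos i
  field_simp
  ring

lemma tvNorm_noiseSignal {α μ σ : ℝ} (hα : 0 < α) (hσ : 0 ≤ σ) (r : Icc (0 : ℝ) T → ℝ) :
    tvNorm (densityMeasure (p.noiseSignal α μ σ r))
      = ENNReal.ofReal (σ / α * ∑ i : Fin p.N, |r (p.t i.succ)|) := by
  rw [noiseSignal_eq_step, tvNorm_step, Finset.mul_sum]
  congr 1
  refine Finset.sum_congr rfl fun i _ => ?_
  have := p.gap_pos i
  rw [abs_div, abs_mul, abs_of_nonneg hσ, abs_of_pos (mul_pos hα this)]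
  field_simp

lemma roundingDefect_step (c : Fin p.N → ℝ) :
    p.roundingDefect (p.step c) = p.step fun i =>
      1 / p.gap i * (((round (p.gap i * c i)).toNat : ℝ) - p.gap i * c i) := by
  funext s
  by_cases hs : ∃ i, s ∈ p.cell i
  · obtain ⟨i, hi⟩ := hs
    simp only [roundingDefect, step, p.piecewise_of_mem hi]
  · push Not at hs
    simp only [roundingDefect, step, p.piecewise_of_notMem hs]

end TimePartition

/-- The nearest nonnegative integer to `z` is at least as close to `z` as any other
nonnegative integer. -/
lemma abs_round_toNat_sub_le (k : ℕ) (z : ℝ) :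
    |((round z).toNat : ℝ) - z| ≤ |z - k| := by
  have hr : |z - round z| ≤ |z - k| := by simpa using round_le z (k : ℤ)
  rcases le_total 0 (round z) with h | h
  · have : ((round z).toNat : ℝ) = (round z : ℝ) := by exact_mod_cast Int.toNat_of_nonneg h
    rw [this, abs_sub_comm]
    exact hr
  · rw [Int.toNat_of_nonpos h, Nat.cast_zero]
    have hk : (0 : ℝ) ≤ k := k.cast_nonneg
    have h' : ((round z : ℤ) : ℝ) ≤ 0 := by exact_mod_cast h
    rcases le_total z 0 with hz | hz
    · rw [abs_of_nonneg (by linarith), abs_of_nonpos (by linarith)]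
      linarith
    · refine le_trans ?_ hr
      rw [abs_of_nonpos (by linarith), abs_of_nonneg (by linarith)]
      linarith

namespace TimePartition

variable {T : ℝ} (p : TimePartition T)

/-- The rounding error is controlled by the noise as soon as the detection events are integer
valued. -/
lemma tvNorm_roundingDefect_le {α μ σ : ℝ} (hα : 0 < α) (hσ : 0 ≤ σ)
    {ε : Measure (Icc (0 : ℝ) T)} (hε : ∀ i, ∃ k : ℕ, ε.real (p.cell i) = k)
    (r : Icc (0 : ℝ) T → ℝ) :
    tvNorm (densityMeasure (p.roundingDefect (p.measSignal α μ σ ε r)))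
      ≤ ENNReal.ofReal (σ / α * ∑ i : Fin p.N, |r (p.t i.succ)|) := by
  rw [measSignal_eq_step p α μ σ hα, roundingDefect_step, tvNorm_step, Finset.mul_sum]
  refine ENNReal.ofReal_le_ofReal (Finset.sum_le_sum fun i _ => ?_)
  have hg := p.gap_pos i
  obtain ⟨k, hk⟩ := hε i
  have h1 : p.gap i * ((p.countVec ε i + σ * r (p.t i.succ) / α) / p.gap i)
      = k + σ * r (p.t i.succ) / α := by
    rw [countVec, hk]
    field_simp
  rw [h1, abs_mul, abs_of_pos (by positivity : 0 < 1 / p.gap i)]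
  have h2 := abs_round_toNat_sub_le k (k + σ * r (p.t i.succ) / α)
  rw [add_sub_cancel_left, abs_div, abs_mul, abs_of_nonneg hσ, abs_of_pos hα] at h2
  calc 1 / p.gap i * |_| * p.gap i = |_| := by field_simp
    _ ≤ _ := h2
    _ = _ := by ring

lemma integral_noiseSignal (α μ σ : ℝ) (r : Icc (0 : ℝ) T → ℝ) (φ : C(Icc (0 : ℝ) T, ℝ)) :
    ∫ᵛ s, φ s ∂<•(densityMeasure (p.noiseSignal α μ σ r))
      = σ / α * ∑ i : Fin p.N, p.cellMean φ i * r (p.t i.succ) := by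
  rw [noiseSignal_eq_step, integral_step, Finset.mul_sum]
  refine Finset.sum_congr rfl fun i _ => ?_
  rw [cellMean, mul_comm α, div_mul_eq_div_div]
  ring

lemma integral_measSignal {α : ℝ} (hα : 0 < α) (μ σ : ℝ) (ε : Measure (Icc (0 : ℝ) T))
    (r : Icc (0 : ℝ) T → ℝ) (φ : C(Icc (0 : ℝ) T, ℝ)) :
    ∫ᵛ s, φ s ∂<•(densityMeasure (p.measSignal α μ σ ε r))
      = ∑ i, ε.real (p.cell i) * p.cellMean φ i
        + ∫ᵛ s, φ s ∂<•(densityMeasure (p.noiseSignal α μ σ r)) := by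
  rw [integral_noiseSignal, measSignal_eq_step p α μ σ hα, integral_step, Finset.mul_sum,
    ← Finset.sum_add_distrib]
  refine Finset.sum_congr rfl fun i _ => ?_
  rw [cellMean, countVec]
  have hg := p.gap_pos i
  field_simp

/-- Binning a finite measure without mass at the end point `T` changes its integrals little if
the test function varies little over the cells. -/
lemma abs_sum_cellMean_sub_integral_le {ε : Measure (Icc (0 : ℝ) T)} [IsFiniteMeasure ε]
    (hT : ∀ᵐ s : Icc (0 : ℝ) T ∂ε, (s : ℝ) < T) {φ : C(Icc (0 : ℝ) T, ℝ)} {η : ℝ}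
    (hφ : ∀ i, ∀ s ∈ p.cell i, ∀ s' ∈ p.cell i, |φ s - φ s'| ≤ η) :
    |∑ i, ε.real (p.cell i) * p.cellMean φ i - ∫ s, φ s ∂ε| ≤ η * ε.real univ := by
  have hcov : ε (⋃ i, p.cell i)ᶜ = 0 := by
    refine measure_mono_null (fun s hs => ?_) hT
    intro h
    obtain ⟨i, hi⟩ := p.exists_mem_cell h
    exact hs (mem_iUnion.2 ⟨i, hi⟩)
  have hcov' : (⋃ i, p.cell i : Set (Icc (0 : ℝ) T)) =ᵐ[ε] univ := by
    rw [ae_eq_univ]; exact hcov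
  have h1 : ∫ s, φ s ∂ε = ∑ i, ∫ s in p.cell i, φ s ∂ε := by
    rw [← integral_iUnion_fintype p.measurableSet_cell p.pairwise_disjoint_cell
      fun i => (integrable_continuousMap φ).integrableOn, setIntegral_congr_set hcov',
      Measure.restrict_univ]
  have h2 : ε.real univ = ∑ i, ε.real (p.cell i) := by
    rw [← measureReal_iUnion_fintype p.pairwise_disjoint_cell p.measurableSet_cell]
    exact (measureReal_congr hcov').symm
  rw [h1, h2, ← Finset.sum_sub_distrib, Finset.mul_sum]
  refine (Finset.abs_sum_le_sum_abs _ _).trans (Finset.sum_le_sum fun i _ => ?_)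
  have h3 : ε.real (p.cell i) * p.cellMean φ i - ∫ s in p.cell i, φ s ∂ε
      = ∫ s in p.cell i, (p.cellMean φ i - φ s) ∂ε := by
    rw [integral_sub (integrable_const _) (integrable_continuousMap φ), setIntegral_const,
      smul_eq_mul]
  rw [h3]
  exact norm_setIntegral_le_of_norm_le_const (f := fun s => p.cellMean φ i - φ s)
    (measure_lt_top _ _) fun s hs => p.abs_cellMean_sub_le fun s' hs' => hφ i s' hs' s hs

end TimePartition

lemma tendsto_sum_cellMean {T : ℝ} {p : ℕ → TimePartition T}
    (hmesh : Tendsto (fun n => (p n).mesh) atTop (𝓝 0))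
    {ε : Measure (Icc (0 : ℝ) T)} [IsFiniteMeasure ε] (hT : ∀ᵐ s : Icc (0 : ℝ) T ∂ε, (s : ℝ) < T)
    (φ : C(Icc (0 : ℝ) T, ℝ)) :
    Tendsto (fun n => ∑ i, ε.real ((p n).cell i) * (p n).cellMean φ i) atTop
      (𝓝 (∫ s, φ s ∂ε)) := by
  rw [Metric.tendsto_atTop']
  intro δ hδ
  set η : ℝ := δ / (2 * (ε.real univ + 1)) with hη
  have hm : 0 ≤ ε.real univ := measureReal_nonneg
  have hη0 : 0 < η := by positivity
  obtain ⟨ρ, hρ, hu⟩ := Metric.uniformContinuous_iff.1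
    (CompactSpace.uniformContinuous_of_continuous φ.continuous) η hη0
  obtain ⟨n₀, hn₀⟩ := eventually_atTop.1 (hmesh.eventually (gt_mem_nhds hρ))
  refine ⟨n₀, fun n hn => ?_⟩
  have key := (p n).abs_sum_cellMean_sub_integral_le hT (φ := φ) (η := η) ?_
  · rw [Real.dist_eq]
    refine key.trans_lt ?_
    rw [hη, div_mul_eq_mul_div, div_lt_iff₀ (by positivity)]
    nlinarith
  · intro i s hs s' hs'
    refine (hu ?_).le
    have hg := ((p n).gap_le_mesh i).trans_lt (hn₀ n hn.le)
    rw [Subtype.dist_eq, Real.dist_eq, abs_lt]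
    have h1 : (((p n).t i.castSucc : Icc (0 : ℝ) T) : ℝ) ≤ s := hs.1
    have h2 : (s : ℝ) < ((p n).t i.succ : Icc (0 : ℝ) T) := hs.2
    have h3 : (((p n).t i.castSucc : Icc (0 : ℝ) T) : ℝ) ≤ s' := hs'.1
    have h4 : (s' : ℝ) < ((p n).t i.succ : Icc (0 : ℝ) T) := hs'.2
    rw [TimePartition.gap] at hg
    constructor <;> linarith

end ScanLimit

/-! ### Averages of white noise -/

namespace ScanLimit

variable {T : ℝ}

instance : IsProbabilityMeasure (whiteNoise T) := by
  unfold whiteNoise; infer_instance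

lemma TimePartition.injective_succ (p : TimePartition T) :
    Function.Injective fun i : Fin p.N => p.t i.succ :=
  p.strictMono.injective.comp (Fin.succ_injective _)

/-- **Chernoff bound** for sums of functions of white noise at the partition points. -/
lemma whiteNoise_sum_nonneg_le (p : TimePartition T) {h : Fin p.N → ℝ → ℝ}
    (hm : ∀ i, Measurable (h i)) {q : ℝ}
    (hi : ∀ i, Integrable (fun x => Real.exp (h i x)) (gaussianReal 0 1))
    (hq : ∀ i, ∫ x, Real.exp (h i x) ∂(gaussianReal 0 1) ≤ q) :
    whiteNoise T {r | 0 ≤ ∑ i, h i (r (p.t i.succ))} ≤ ENNReal.ofReal (q ^ p.N) := by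
  set X : Fin p.N → (Icc (0 : ℝ) T → ℝ) → ℝ := fun i r => h i (r (p.t i.succ)) with hX
  have hXm : ∀ i, Measurable (X i) := fun i => (hm i).comp (measurable_pi_apply _)
  have hind : iIndepFun X (whiteNoise T) :=
    ((iIndepFun_infinitePi (P := fun _ : Icc (0 : ℝ) T => gaussianReal 0 1)
      (X := fun _ x => x) fun _ => measurable_id).precomp p.injective_succ).comp h hm
  have hmp : ∀ i : Fin p.N, MeasurePreserving (fun r : Icc (0 : ℝ) T → ℝ => r (p.t i.succ))
      (whiteNoise T) (gaussianReal 0 1) := fun i =>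
    measurePreserving_eval_infinitePi (fun _ => gaussianReal 0 1) _
  have hXi : ∀ i, Integrable (fun r => Real.exp (1 * X i r)) (whiteNoise T) := by
    intro i
    simp only [one_mul]
    exact (hmp i).integrable_comp_of_integrable (hi i)
  have hmgf : ∀ i, mgf (X i) (whiteNoise T) 1 = ∫ x, Real.exp (h i x) ∂(gaussianReal 0 1) := by
    intro i
    rw [mgf, ← (hmp i).map_eq, integral_map (hmp i).aemeasurable
      ((hm i).exp.aestronglyMeasurable)]
    simp [hX]
  have hsum : Integrable (fun r => Real.exp (1 * (∑ i, X i) r)) (whiteNoise T) :=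
    hind.integrable_exp_mul_sum hXm fun i _ => hXi i
  have key := measure_ge_le_exp_mul_mgf (X := ∑ i, X i) (μ := whiteNoise T) 0 zero_le_one hsum
  rw [hind.mgf_sum hXm, mul_zero, Real.exp_zero, one_mul] at key
  have hle : ∏ i, mgf (X i) (whiteNoise T) 1 ≤ q ^ p.N := by
    calc ∏ i, mgf (X i) (whiteNoise T) 1 ≤ ∏ _i : Fin p.N, q :=
          Finset.prod_le_prod (fun i _ => mgf_nonneg) fun i _ => (hmgf i).trans_le (hq i)
      _ = _ := by simp
  have hset : {r : Icc (0 : ℝ) T → ℝ | 0 ≤ ∑ i, h i (r (p.t i.succ))}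
      = {r | 0 ≤ (∑ i, X i) r} := by
    ext r; simp [hX]
  rw [hset, ← ENNReal.ofReal_toReal (measure_ne_top (whiteNoise T) _)]
  exact ENNReal.ofReal_le_ofReal (key.trans hle)

/-- Since the number of intervals is at least `n`, the exponential bounds are summable and the
Borel-Cantelli lemma applies. -/
lemma ae_eventually_sum_neg {p : ℕ → TimePartition T} (hpN : StrictMono fun n => (p n).N)
    {h : ∀ n, Fin (p n).N → ℝ → ℝ} (hm : ∀ n i, Measurable (h n i)) {q : ℝ} (hq0 : 0 ≤ q)
    (hq1 : q < 1) (hi : ∀ n i, Integrable (fun x => Real.exp (h n i x)) (gaussianReal 0 1))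
    (hq : ∀ n i, ∫ x, Real.exp (h n i x) ∂(gaussianReal 0 1) ≤ q) :
    ∀ᵐ r ∂(whiteNoise T), ∀ᶠ n in atTop, ∑ i, h n i (r ((p n).t i.succ)) < 0 := by
  have hs : ∑' n, whiteNoise T {r | 0 ≤ ∑ i, h n i (r ((p n).t i.succ))} ≠ ∞ := by
    refine ne_top_of_le_ne_top ?_ (ENNReal.tsum_le_tsum fun n =>
      (whiteNoise_sum_nonneg_le (p n) (hm n) (hi n) (hq n)).trans (ENNReal.ofReal_le_ofReal
        (pow_le_pow_of_le_one hq0 hq1.le hpN.le_apply)))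
    rw [← ENNReal.ofReal_tsum_of_nonneg (fun n => pow_nonneg hq0 n)
      (summable_geometric_of_lt_one hq0 hq1)]
    exact ENNReal.ofReal_ne_top
  filter_upwards [ae_eventually_notMem hs] with r hr
  filter_upwards [hr] with n hn
  simpa using hn

lemma integrable_exp_abs_gaussian :
    Integrable (fun x => Real.exp |x|) (gaussianReal 0 1) := by
  have := integrable_exp_mul_abs (X := fun x : ℝ => x) (μ := gaussianReal 0 1) (t := 1)
    (by simpa using integrable_exp_mul_gaussianReal (μ := 0) (v := 1) 1)
    (by simpa using integrable_exp_mul_gaussianReal (μ := 0) (v := 1) (-1))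
  simpa using this

/-- Almost surely, the absolute values of the noise have bounded averages. -/
lemma exists_ae_sum_abs_le {p : ℕ → TimePartition T} (hpN : StrictMono fun n => (p n).N) :
    ∃ C : ℝ, ∀ᵐ r ∂(whiteNoise T), ∀ᶠ n in atTop,
      ∑ i : Fin (p n).N, |r ((p n).t i.succ)| ≤ C * (p n).N := by
  set J := ∫ x, Real.exp |x| ∂(gaussianReal 0 1) with hJ
  have hJ1 : 0 ≤ J := integral_nonneg fun x => (Real.exp_pos _).le
  obtain ⟨C, hC⟩ : ∃ C : ℝ, J * Real.exp (-C) ≤ 1 / 2 := by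
    have : Tendsto (fun C : ℝ => J * Real.exp (-C)) atTop (𝓝 (J * 0)) :=
      (Real.tendsto_exp_neg_atTop_nhds_zero).const_mul J
    rw [mul_zero] at this
    exact (this.eventually (ge_mem_nhds (by norm_num))).exists
  have hexp : ∀ x : ℝ, Real.exp (|x| - C) = Real.exp |x| * Real.exp (-C) := fun x => by
    rw [← Real.exp_add, sub_eq_add_neg]
  refine ⟨C, ?_⟩
  have := ae_eventually_sum_neg (T := T) hpN (h := fun _ _ x => |x| - C) (q := 1 / 2)
    (fun _ _ => by fun_prop) (by norm_num) (by norm_num)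
    (fun _ _ => by
      simp_rw [hexp]
      exact integrable_exp_abs_gaussian.mul_const _)
    (fun _ _ => by
      simp_rw [hexp]
      rwa [integral_mul_const])
  filter_upwards [this] with r hr
  filter_upwards [hr] with n hn
  simp only [Finset.sum_sub_distrib, Finset.sum_const, Finset.card_univ, Fintype.card_fin,
    nsmul_eq_mul] at hn
  linarith

/-- Almost surely, the absolute values of the noise have averages bounded away from zero. -/
lemma exists_ae_le_sum_abs {p : ℕ → TimePartition T} (hpN : StrictMono fun n => (p n).N) :
    ∃ c : ℝ, 0 < c ∧ ∀ᵐ r ∂(whiteNoise T), ∀ᶠ n in atTop,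
      c * (p n).N ≤ ∑ i : Fin (p n).N, |r ((p n).t i.succ)| := by
  have hint : Integrable (fun x => Real.exp (-|x|)) (gaussianReal 0 1) :=
    Integrable.of_bound (by fun_prop) 1 (ae_of_all _ fun x => by simp)
  set J := ∫ x, Real.exp (-|x|) ∂(gaussianReal 0 1) with hJ
  have hJ0 : 0 ≤ J := integral_nonneg fun x => (Real.exp_pos _).le
  have hJ1 : J < 1 := by
    have hpos : 0 < ∫ x, (1 - Real.exp (-|x|)) ∂(gaussianReal 0 1) := by
      rw [integral_pos_iff_support_of_nonneg]
      · have : (Function.support fun x : ℝ => 1 - Real.exp (-|x|)) = {0}ᶜ := by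
          ext x
          rw [Function.mem_support, sub_ne_zero, mem_compl_singleton_iff, ne_comm, not_iff_not,
            Real.exp_eq_one_iff, neg_eq_zero, abs_eq_zero]
        rw [this, prob_compl_eq_one_sub (measurableSet_singleton _)]
        have : gaussianReal 0 1 {(0 : ℝ)} = 0 :=
          have := nullSingletonClass_gaussianReal (μ := 0) (v := 1) one_ne_zero
          measure_singleton _
        simp [this]
      · intro x
        simp
      · exact (integrable_const _).sub hint
    rw [integral_sub (integrable_const _) hint] at hpos
    simpa using hpos
  obtain ⟨c, hc0, hc⟩ : ∃ c : ℝ, 0 < c ∧ J * Real.exp c < 1 := by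
    have : Tendsto (fun c : ℝ => J * Real.exp c) (𝓝[>] 0) (𝓝 (J * Real.exp 0)) :=
      ((by fun_prop : Continuous fun c : ℝ => J * Real.exp c).tendsto 0).mono_left
        nhdsWithin_le_nhds
    rw [Real.exp_zero, mul_one] at this
    obtain ⟨c, h1, h2⟩ := ((this.eventually (gt_mem_nhds hJ1)).and self_mem_nhdsWithin).exists
    exact ⟨c, h2, h1⟩
  have hexp : ∀ x : ℝ, Real.exp (c - |x|) = Real.exp (-|x|) * Real.exp c := fun x => by
    rw [← Real.exp_add]; ring_nf
  refine ⟨c, hc0, ?_⟩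
  have := ae_eventually_sum_neg (T := T) hpN (h := fun _ _ x => c - |x|)
    (q := J * Real.exp c)
    (fun _ _ => by fun_prop) (by positivity) hc
    (fun _ _ => by
      simp_rw [hexp]
      exact hint.mul_const _)
    (fun _ _ => by
      simp_rw [hexp]
      rw [integral_mul_const])
  filter_upwards [this] with r hr
  filter_upwards [hr] with n hn
  simp only [Finset.sum_sub_distrib, Finset.sum_const, Finset.card_univ, Fintype.card_fin,
    nsmul_eq_mul] at hn
  linarith

/-- A one-sided law of large numbers for weighted averages of white noise. -/
lemma ae_eventually_sum_mul_lt {p : ℕ → TimePartition T} (hpN : StrictMono fun n => (p n).N)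
    {a : ∀ n, Fin (p n).N → ℝ} {A : ℝ} (ha : ∀ n i, |a n i| ≤ A) {δ : ℝ} (hδ : 0 < δ) :
    ∀ᵐ r ∂(whiteNoise T), ∀ᶠ n in atTop,
      ∑ i, a n i * r ((p n).t i.succ) < δ * (p n).N := by
  -- the exponent `s` is small enough for `s ^ 2 * a ^ 2 / 2 ≤ s * δ / 2`
  set s : ℝ := δ / (A ^ 2 + 1) with hs
  have hs0 : 0 < s := by positivity
  have hsA : s * A ^ 2 ≤ δ := by
    rw [hs, div_mul_eq_mul_div, div_le_iff₀ (by positivity)]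
    nlinarith
  have hexp : ∀ b x : ℝ, Real.exp (s * (b * x - δ))
      = Real.exp (s * b * x) * Real.exp (-(s * δ)) := fun b x => by
    rw [← Real.exp_add]; ring_nf
  have := ae_eventually_sum_neg (T := T) hpN (h := fun n i x => s * (a n i * x - δ))
    (q := Real.exp (-(s * δ / 2)))
    (fun _ _ => by fun_prop) (Real.exp_pos _).le (by
      rw [Real.exp_lt_one_iff]
      have : 0 < s * δ := by positivity
      linarith)
    (fun n i => by
      simp_rw [hexp]
      exact (integrable_exp_mul_gaussianReal _).mul_const _)
    (fun n i => by
      simp_rw [hexp]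
      rw [integral_mul_const]
      have hmgf := congrFun (mgf_fun_id_gaussianReal (μ := 0) (v := 1)) (s * a n i)
      rw [mgf] at hmgf
      rw [hmgf, ← Real.exp_add, Real.exp_le_exp]
      have h1 : a n i ^ 2 ≤ A ^ 2 := sq_le_sq' (abs_le.1 (ha n i)).1 (abs_le.1 (ha n i)).2
      have h2 : s ^ 2 * a n i ^ 2 ≤ s * δ := by
        calc s ^ 2 * a n i ^ 2 ≤ s ^ 2 * A ^ 2 := by gcongr
          _ = s * (s * A ^ 2) := by ring
          _ ≤ s * δ := by gcongr
      simp only [zero_mul, NNReal.coe_one, one_mul, zero_add, mul_pow]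
      linarith)
  filter_upwards [this] with r hr
  filter_upwards [hr] with n hn
  rw [← Finset.mul_sum] at hn
  have := neg_of_mul_neg_right hn hs0.le
  simp only [Finset.sum_sub_distrib, Finset.sum_const, Finset.card_univ, Fintype.card_fin,
    nsmul_eq_mul] at this
  linarith

lemma ae_eventually_abs_sum_mul_lt {p : ℕ → TimePartition T} (hpN : StrictMono fun n => (p n).N)
    {a : ∀ n, Fin (p n).N → ℝ} {A : ℝ} (ha : ∀ n i, |a n i| ≤ A) {δ : ℝ} (hδ : 0 < δ) :
    ∀ᵐ r ∂(whiteNoise T), ∀ᶠ n in atTop,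
      |∑ i, a n i * r ((p n).t i.succ)| < δ * (p n).N := by
  filter_upwards [ae_eventually_sum_mul_lt hpN ha hδ,
    ae_eventually_sum_mul_lt (a := fun n i => -a n i) hpN (A := A)
      (fun n i => by simpa using ha n i) hδ] with r h1 h2
  filter_upwards [h1, h2] with n h3 h4
  simp only [neg_mul, Finset.sum_neg_distrib] at h4
  exact abs_lt.2 ⟨by linarith, h3⟩

/-- Almost surely, the noise vanishes in the limit in total variation if `σ N / α → 0`. -/
lemma ae_tendsto_noise_zero {α : ℝ} (hα : 0 < α) {p : ℕ → TimePartition T}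
    (hpN : StrictMono fun n => (p n).N) {σ : ℕ → ℝ} (hσ : ∀ n, 0 ≤ σ n)
    (h0 : Tendsto (fun n => σ n * (p n).N / α) atTop (𝓝 0)) :
    ∀ᵐ r ∂(whiteNoise T), Tendsto (fun n =>
      ENNReal.ofReal (σ n / α * ∑ i : Fin (p n).N, |r ((p n).t i.succ)|)) atTop (𝓝 0) := by
  obtain ⟨C, hC⟩ := exists_ae_sum_abs_le (T := T) hpN
  filter_upwards [hC] with r hr
  rw [← ENNReal.ofReal_zero]
  refine ENNReal.tendsto_ofReal ?_
  refine squeeze_zero' (.of_forall fun n => mul_nonneg (div_nonneg (hσ n) hα.le)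
    (Finset.sum_nonneg fun i _ => abs_nonneg _)) ?_ (by simpa using h0.const_mul C)
  filter_upwards [hr] with n hn
  calc σ n / α * _ ≤ σ n / α * (C * (p n).N) :=
        mul_le_mul_of_nonneg_left hn (div_nonneg (hσ n) hα.le)
    _ = _ := by ring

lemma ae_tendsto_noise_top {α : ℝ} (hα : 0 < α) {p : ℕ → TimePartition T}
    (hpN : StrictMono fun n => (p n).N) {σ : ℕ → ℝ} (hσ : ∀ n, 0 ≤ σ n)
    (h0 : Tendsto (fun n => σ n * (p n).N / α) atTop atTop) :
    ∀ᵐ r ∂(whiteNoise T), Tendsto (fun n =>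
      ENNReal.ofReal (σ n / α * ∑ i : Fin (p n).N, |r ((p n).t i.succ)|)) atTop (𝓝 ∞) := by
  obtain ⟨c, hc0, hc⟩ := exists_ae_le_sum_abs (T := T) hpN
  filter_upwards [hc] with r hr
  refine ENNReal.tendsto_ofReal_nhds_top.2 ?_
  refine tendsto_atTop_mono' _ ?_ (h0.const_mul_atTop hc0)
  filter_upwards [hr] with n hn
  calc c * (σ n * (p n).N / α) = σ n / α * (c * (p n).N) := by ring
    _ ≤ _ := mul_le_mul_of_nonneg_left hn (div_nonneg (hσ n) hα.le)

/-- Almost surely, the noise converges weakly-* to zero if `σ N / α` has a finite limit: for each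
test function this is a law of large numbers, and a countable dense set of test functions
suffices since the total variations are bounded. -/
lemma ae_weakStarConv_noise {α μ : ℝ} (hα : 0 < α) {p : ℕ → TimePartition T}
    (hpN : StrictMono fun n => (p n).N) {σ : ℕ → ℝ} (hσ : ∀ n, 0 ≤ σ n) {c : ℝ}
    (hc : Tendsto (fun n => σ n * (p n).N / α) atTop (𝓝 c)) :
    ∀ᵐ r ∂(whiteNoise T),
      WeakStarConv (fun n => densityMeasure ((p n).noiseSignal α μ (σ n) r)) 0 := by
  obtain ⟨C, hC⟩ := exists_ae_sum_abs_le (T := T) hpN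
  have hdense : ∀ᵐ r ∂(whiteNoise T), ∀ j k : ℕ, ∀ᶠ n in atTop,
      |∑ i, (p n).cellMean (TopologicalSpace.denseSeq C(Icc (0 : ℝ) T, ℝ) j) i
        * r ((p n).t i.succ)| < 1 / ((k : ℝ) + 1) * (p n).N :=
    ae_all_iff.2 fun j => ae_all_iff.2 fun k => ae_eventually_abs_sum_mul_lt hpN
      (fun n i => (p n).abs_cellMean_le _ i) (by positivity)
  filter_upwards [hC, hdense] with r hr1 hr2 φ
  simp_rw [TimePartition.integral_noiseSignal]
  rw [VectorMeasure.integral_zero_vectorMeasure, Metric.tendsto_atTop']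
  intro δ hδ
  -- the choice of `η` balances the limit `c` against the bound `C` on the averages of the noise
  have hc0 : 0 ≤ c := ge_of_tendsto' hc fun n =>
    div_nonneg (mul_nonneg (hσ n) (Nat.cast_nonneg _)) hα.le
  set D : ℝ := (c + 1) * (|C| + 1) with hD
  have hD0 : 0 < D := by positivity
  set η : ℝ := δ / (2 * D) with hη
  have hη0 : 0 < η := by positivity
  obtain ⟨j, hj⟩ : ∃ j, ‖φ - TopologicalSpace.denseSeq C(Icc (0 : ℝ) T, ℝ) j‖ < η := by
    obtain ⟨j, hj⟩ :=
      (TopologicalSpace.denseRange_denseSeq C(Icc (0 : ℝ) T, ℝ)).exists_dist_lt φ hη0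
    exact ⟨j, by rwa [← dist_eq_norm]⟩
  set ψ := TopologicalSpace.denseSeq C(Icc (0 : ℝ) T, ℝ) j with hψ
  obtain ⟨k, hk⟩ := exists_nat_one_div_lt hη0
  have hev := ((hr1.and (hr2 j k)).and (hc.eventually (gt_mem_nhds (lt_add_one c)))).and
    (eventually_gt_atTop 0)
  obtain ⟨n₀, hn₀⟩ := eventually_atTop.1 hev
  refine ⟨n₀, fun n hn => ?_⟩
  obtain ⟨⟨⟨h1, h2⟩, h3⟩, h4⟩ := hn₀ n hn.le
  have hN : 0 < ((p n).N : ℝ) := by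
    have : n ≤ (p n).N := hpN.le_apply
    exact_mod_cast h4.trans_le this
  have hdiff : ∀ i, |(p n).cellMean φ i - (p n).cellMean ψ i| ≤ η := by
    intro i
    have : (p n).cellMean φ i - (p n).cellMean ψ i = (p n).cellMean (φ - ψ) i := by
      simp only [TimePartition.cellMean, ContinuousMap.sub_apply]
      rw [integral_sub (integrable_continuousMap φ) (integrable_continuousMap ψ)]
      ring
    rw [this]
    exact ((p n).abs_cellMean_le _ i).trans hj.le
  have h5 : |∑ i, (p n).cellMean φ i * r ((p n).t i.succ)| < η * ((|C| + 1) * (p n).N) := by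
    have e : ∑ i, (p n).cellMean φ i * r ((p n).t i.succ)
        = ∑ i, ((p n).cellMean φ i - (p n).cellMean ψ i) * r ((p n).t i.succ)
          + ∑ i, (p n).cellMean ψ i * r ((p n).t i.succ) := by
      rw [← Finset.sum_add_distrib]
      exact Finset.sum_congr rfl fun i _ => by ring
    have e1 : |∑ i, ((p n).cellMean φ i - (p n).cellMean ψ i) * r ((p n).t i.succ)|
        ≤ η * (|C| * (p n).N) := by
      calc _ ≤ ∑ i : Fin (p n).N, η * |r ((p n).t i.succ)| := by
            refine (Finset.abs_sum_le_sum_abs _ _).trans (Finset.sum_le_sum fun i _ => ?_)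
            rw [abs_mul]
            exact mul_le_mul_of_nonneg_right (hdiff i) (abs_nonneg _)
        _ ≤ _ := by
            rw [← Finset.mul_sum]
            refine mul_le_mul_of_nonneg_left (h1.trans ?_) hη0.le
            exact mul_le_mul_of_nonneg_right (le_abs_self C) hN.le
    have e2 : 1 / ((k : ℝ) + 1) * (p n).N < η * (p n).N := mul_lt_mul_of_pos_right hk hN
    rw [e]
    refine (abs_add_le _ _).trans_lt ?_
    calc _ < η * (|C| * (p n).N) + η * (p n).N := by linarith
      _ = _ := by ring
  rw [dist_zero_right, Real.norm_eq_abs, abs_mul, abs_of_nonneg (div_nonneg (hσ n) hα.le)]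
  calc σ n / α * _ ≤ σ n / α * (η * ((|C| + 1) * (p n).N)) :=
        mul_le_mul_of_nonneg_left h5.le (div_nonneg (hσ n) hα.le)
    _ = η * (|C| + 1) * (σ n * (p n).N / α) := by ring
    _ ≤ η * (|C| + 1) * (c + 1) := by gcongr
    _ = η * D := by rw [hD]; ring
    _ < δ := by
      rw [hη, div_mul_eq_mul_div, div_lt_iff₀ (by positivity)]
      nlinarith

end ScanLimit

/-! ### Counts of a Poisson point process -/

namespace ScanLimit

namespace IsPoissonPointProcess

variable {Ω E : Type*} [MeasurableSpace Ω] [MeasurableSpace E] {X : Ω → Set E} {m : Measure E}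
  {P : Measure Ω}

lemma measurableSet_encard_eq (hX : IsPoissonPointProcess X m P) {S : Set E}
    (hS : MeasurableSet S) (k : ℕ∞) : MeasurableSet {ω | (X ω ∩ S).encard = k} :=
  hX.measurable_count S hS (measurableSet_singleton k)

lemma measurableSet_forall_encard_eq (hX : IsPoissonPointProcess X m P) {ι : Type*} [Countable ι]
    {C : ι → Set E} (hC : ∀ j, MeasurableSet (C j)) (k : ι → ℕ) :
    MeasurableSet {ω | ∀ j, (X ω ∩ C j).encard = k j} := by
  rw [ofPred_forall]
  exact MeasurableSet.iInter fun j => hX.measurableSet_encard_eq (hC j) _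

lemma real_encard_eq (hX : IsPoissonPointProcess X m P) {S : Set E}
    (hS : MeasurableSet S) (hm : m S ≠ ∞) (k : ℕ) :
    P.real {ω | (X ω ∩ S).encard = k}
      = Real.exp (-m.real S) * m.real S ^ k / (k.factorial : ℝ) := by
  have h1 := congrArg (fun ν : Measure ℕ∞ => ν.real {(k : ℕ∞)}) (hX.map_count S hS hm)
  rw [map_measureReal_apply (hX.measurable_count S hS) (measurableSet_singleton _),
    map_measureReal_apply .of_discrete (measurableSet_singleton _)] at h1
  have h2 : (fun k : ℕ => (k : ℕ∞)) ⁻¹' {(k : ℕ∞)} = {k} := by ext; simp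
  rw [h2, poissonMeasure_real_singleton] at h1
  exact h1

lemma real_inter_eq_empty (hX : IsPoissonPointProcess X m P) {S : Set E}
    (hS : MeasurableSet S) (hm : m S ≠ ∞) :
    P.real {ω | X ω ∩ S = ∅} = Real.exp (-m.real S) := by
  have := hX.real_encard_eq hS hm 0
  simpa using this

lemma ae_inter_eq_empty [IsProbabilityMeasure P] (hX : IsPoissonPointProcess X m P) {S : Set E}
    (hS : MeasurableSet S) (hm : m S = 0) : ∀ᵐ ω ∂P, X ω ∩ S = ∅ := by
  have h1 := hX.real_inter_eq_empty hS (by simp [hm])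
  rw [measureReal_def m, hm] at h1
  have h2 : MeasurableSet {ω | X ω ∩ S = ∅} := by
    simpa using hX.measurableSet_encard_eq hS 0
  refine (mem_ae_iff_prob_eq_one h2).2 ?_
  rw [← ENNReal.ofReal_toReal (measure_ne_top P _), ← measureReal_def, h1]
  simp

lemma ae_finite_inter [IsProbabilityMeasure P] (hX : IsPoissonPointProcess X m P) {S : Set E}
    (hS : MeasurableSet S) (hm : m S ≠ ∞) : ∀ᵐ ω ∂P, (X ω ∩ S).Finite := by
  have h1 := congrArg (fun ν : Measure ℕ∞ => ν {⊤}) (hX.map_count S hS hm)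
  rw [Measure.map_apply (hX.measurable_count S hS) (measurableSet_singleton _),
    Measure.map_apply .of_discrete (measurableSet_singleton _)] at h1
  have h2 : (fun k : ℕ => (k : ℕ∞)) ⁻¹' {⊤} = ∅ := by ext; simp
  rw [h2, measure_empty] at h1
  rw [ae_iff]
  convert h1 using 2
  ext ω
  simp

/-- The counts in finitely many disjoint sets are independent Poisson variables. -/
lemma real_forall_encard_eq (hX : IsPoissonPointProcess X m P) {ι : Type*} [Fintype ι]
    {C : ι → Set E} (hC : ∀ j, MeasurableSet (C j)) (hd : Pairwise (Function.onFun Disjoint C))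
    (hm : ∀ j, m (C j) ≠ ∞) (k : ι → ℕ) :
    P.real {ω | ∀ j, (X ω ∩ C j).encard = k j}
      = ∏ j, Real.exp (-m.real (C j)) * m.real (C j) ^ k j / ((k j).factorial : ℝ) := by
  have hind := hX.iIndepFun_count (Fintype.card ι) (fun i => C ((Fintype.equivFin ι).symm i))
    (fun i => hC _) fun i j hij => hd ((Fintype.equivFin ι).symm.injective.ne hij)
  have hind' : iIndepFun (fun j ω => (X ω ∩ C j).encard) P := by
    have := hind.precomp (Fintype.equivFin ι).injective
    simpa using this
  have key := hind'.meas_iInter (s := fun j => {ω | (X ω ∩ C j).encard = k j})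
    fun j => ⟨{(k j : ℕ∞)}, measurableSet_singleton _, rfl⟩
  rw [measureReal_def, ofPred_forall, key, ENNReal.toReal_prod]
  exact Finset.prod_congr rfl fun j _ => hX.real_encard_eq (hC j) (hm j) (k j)

/-- Given the counts `k j` of points in disjoint sets `C j`, the points are independent and
uniformly distributed, so that all of them avoid `D` with probability at least `c ^ ∑ j, k j` if
the proportion of `C j` outside `D` is at least `c`. -/
lemma pow_mul_real_le [IsProbabilityMeasure P] (hX : IsPoissonPointProcess X m P) {ι : Type*}
    [Fintype ι] {C : ι → Set E}
    (hC : ∀ j, MeasurableSet (C j)) (hd : Pairwise (Function.onFun Disjoint C))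
    (hm : ∀ j, m (C j) ≠ ∞) {D : Set E} (hD : MeasurableSet D) (k : ι → ℕ) {c : ℝ} (hc : 0 ≤ c)
    (hcD : ∀ j, k j ≠ 0 → c * m.real (C j) ≤ m.real (C j \ D)) :
    c ^ (∑ j, k j) * P.real {ω | ∀ j, (X ω ∩ C j).encard = k j}
      ≤ P.real ({ω | ∀ j, (X ω ∩ C j).encard = k j} ∩ {ω | ∀ j, X ω ∩ (C j ∩ D) = ∅}) := by
  set C' : ι × Bool → Set E := fun q => if q.2 then C q.1 ∩ D else C q.1 \ D with hC'
  set k' : ι × Bool → ℕ := fun q => if q.2 then 0 else k q.1 with hk'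
  have hCm : ∀ q, MeasurableSet (C' q) := by
    rintro ⟨j, b⟩
    cases b
    · exact (hC j).diff hD
    · exact (hC j).inter hD
  have hsub : ∀ q, C' q ⊆ C q.1 := by
    rintro ⟨j, b⟩
    cases b
    · exact sdiff_subset
    · exact inter_subset_left
  have hd' : Pairwise (Function.onFun Disjoint C') := by
    rintro ⟨j, b⟩ ⟨j', b'⟩ hne
    by_cases hj : j = j'
    · subst hj
      cases b <;> cases b'
      · exact absurd rfl hne
      · exact disjoint_sdiff_inter
      · exact disjoint_sdiff_inter.symm
      · exact absurd rfl hne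
    · exact (hd hj).mono (hsub _) (hsub _)
  have hm' : ∀ q, m (C' q) ≠ ∞ := fun q => measure_ne_top_of_subset (hsub q) (hm q.1)
  have key := hX.real_forall_encard_eq hCm hd' hm' k'
  have hincl : {ω | ∀ q, (X ω ∩ C' q).encard = k' q} ⊆
      {ω | ∀ j, (X ω ∩ C j).encard = k j} ∩ {ω | ∀ j, X ω ∩ (C j ∩ D) = ∅} := by
    intro ω hω
    have h1 : ∀ j, X ω ∩ (C j ∩ D) = ∅ := fun j => by
      have := hω (j, true)
      simpa [hC', hk'] using this
    refine ⟨fun j => ?_, h1⟩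
    have h2 : (X ω ∩ (C j \ D)).encard = k j := by
      have := hω (j, false)
      simpa [hC', hk'] using this
    have h3 : X ω ∩ C j = X ω ∩ (C j \ D) := by
      rw [← sdiff_union_inter (C j) D, inter_union_distrib_left, h1, union_empty,
        sdiff_union_inter]
    rw [h3, h2]
  refine le_trans ?_ (measureReal_mono hincl)
  rw [key, hX.real_forall_encard_eq hC hd hm k, ← Finset.prod_pow_eq_pow_sum,
    ← Finset.prod_mul_distrib, Fintype.prod_prod_type]
  refine Finset.prod_le_prod (fun j _ => by positivity) fun j _ => ?_
  have hsplit : m.real (C j) = m.real (C j ∩ D) + m.real (C j \ D) :=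
    (measureReal_inter_add_sdiff (s := C j) hD (hm j)).symm
  simp only [Fintype.prod_bool, hC', hk', if_true, Bool.false_eq_true, if_false, pow_zero,
    Nat.factorial_zero, Nat.cast_one, div_one, mul_one]
  have hexp : Real.exp (-m.real (C j))
      = Real.exp (-m.real (C j ∩ D)) * Real.exp (-m.real (C j \ D)) := by
    rw [hsplit, ← Real.exp_add]
    ring_nf
  rw [hexp]
  have hpow : (c * m.real (C j)) ^ k j ≤ m.real (C j \ D) ^ k j := by
    by_cases h0 : k j = 0
    · simp [h0]
    · exact pow_le_pow_left₀ (by positivity) (hcD j h0) _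
  rw [mul_pow] at hpow
  calc c ^ k j * (Real.exp (-m.real (C j ∩ D)) * Real.exp (-m.real (C j \ D))
        * m.real (C j) ^ k j / ((k j).factorial : ℝ))
      = Real.exp (-m.real (C j ∩ D)) * Real.exp (-m.real (C j \ D))
        * (c ^ k j * m.real (C j) ^ k j) / ((k j).factorial : ℝ) := by ring
    _ ≤ Real.exp (-m.real (C j ∩ D)) * Real.exp (-m.real (C j \ D))
        * m.real (C j \ D) ^ k j / ((k j).factorial : ℝ) := by gcongr
    _ = _ := by ring

/-- The bound of `pow_mul_real_le` for events that are determined by the counts. -/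
lemma pow_mul_real_iUnion_le [IsProbabilityMeasure P] (hX : IsPoissonPointProcess X m P)
    {ι : Type*} [Fintype ι] {C : ι → Set E}
    (hC : ∀ j, MeasurableSet (C j)) (hd : Pairwise (Function.onFun Disjoint C))
    (hm : ∀ j, m (C j) ≠ ∞) {D : Set E} (hD : MeasurableSet D) {c : ℝ} (hc : 0 ≤ c) (hc1 : c ≤ 1)
    (K : ℕ) (A : Set (ι → ℕ)) (hA : ∀ k ∈ A, ∑ j, k j ≤ K)
    (hcD : ∀ k ∈ A, ∀ j, k j ≠ 0 → c * m.real (C j) ≤ m.real (C j \ D)) :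
    c ^ K * P.real {ω | ∃ k ∈ A, ∀ j, (X ω ∩ C j).encard = k j}
      ≤ P.real ({ω | ∃ k ∈ A, ∀ j, (X ω ∩ C j).encard = k j}
        ∩ {ω | ∀ j, X ω ∩ (C j ∩ D) = ∅}) := by
  have hB : MeasurableSet {ω | ∀ j, X ω ∩ (C j ∩ D) = ∅} := by
    have := hX.measurableSet_forall_encard_eq (fun j => (hC j).inter hD) (fun _ => 0)
    simpa using this
  have hU : {ω | ∃ k ∈ A, ∀ j, (X ω ∩ C j).encard = k j}
      = ⋃ k : A, {ω | ∀ j, (X ω ∩ C j).encard = (k : ι → ℕ) j} := by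
    ext ω; simp
  have hmeas : ∀ k : A, MeasurableSet {ω | ∀ j, (X ω ∩ C j).encard = (k : ι → ℕ) j} :=
    fun k => hX.measurableSet_forall_encard_eq hC k
  have hdisj : Pairwise (Function.onFun Disjoint
      fun k : A => {ω | ∀ j, (X ω ∩ C j).encard = (k : ι → ℕ) j}) := by
    intro k k' hne
    refine Set.disjoint_left.2 fun ω h h' => hne (Subtype.ext (funext fun j => ?_))
    exact_mod_cast (h j).symm.trans (h' j)
  have key : ENNReal.ofReal (c ^ K) * P {ω | ∃ k ∈ A, ∀ j, (X ω ∩ C j).encard = k j}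
      ≤ P ({ω | ∃ k ∈ A, ∀ j, (X ω ∩ C j).encard = k j} ∩ {ω | ∀ j, X ω ∩ (C j ∩ D) = ∅}) := by
    rw [hU, iUnion_inter, measure_iUnion hdisj hmeas,
      measure_iUnion (fun k k' hne => (hdisj hne).mono inter_subset_left inter_subset_left)
        fun k => (hmeas k).inter hB, ← ENNReal.tsum_mul_left]
    refine ENNReal.tsum_le_tsum fun k => ?_
    have h := hX.pow_mul_real_le hC hd hm hD (k : ι → ℕ) hc (hcD k k.2)
    have h' : c ^ K * P.real {ω | ∀ j, (X ω ∩ C j).encard = (k : ι → ℕ) j}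
        ≤ c ^ (∑ j, (k : ι → ℕ) j) * P.real {ω | ∀ j, (X ω ∩ C j).encard = (k : ι → ℕ) j} :=
      mul_le_mul_of_nonneg_right (pow_le_pow_of_le_one hc hc1 (hA k k.2)) measureReal_nonneg
    have h'' := ENNReal.ofReal_le_ofReal (h'.trans h)
    rwa [ENNReal.ofReal_mul (pow_nonneg hc _), ofReal_measureReal, ofReal_measureReal] at h''
  have := ENNReal.toReal_mono (measure_ne_top _ _) key
  rwa [ENNReal.toReal_mul, ENNReal.toReal_ofReal (pow_nonneg hc _)] at this

/-- Sets `D n` that leave free a fixed proportion `c` of each subset of `R` in the limit are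
missed by the process infinitely often, on the event that there are finitely many points in `R`
and none in `Z`. Otherwise, the decreasing events that all of `D n₀, …, D (n₀ + M - 1)` are hit
would have a limit of positive probability. But each of them is determined by the counts in the
atoms of the partition generated by `D n₀, …, D (n₀ + M - 1)`, hence loses a fixed proportion of
its probability upon intersection with the event that some further `D n` is missed. -/
lemma ae_frequently_inter_eq_empty [IsProbabilityMeasure P] (hX : IsPoissonPointProcess X m P)
    {D : ℕ → Set E} (hD : ∀ n, MeasurableSet (D n)) {R Z : Set E} (hR : MeasurableSet R)
    (hZ : MeasurableSet Z) (hRZ : Disjoint R Z) (hRm : m R ≠ ∞) (hZm : m Z ≠ ∞)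
    (hDRZ : ∀ n, D n ⊆ R ∪ Z) {c : ℝ} (hc : 0 < c) (hc1 : c ≤ 1)
    (hcD : ∀ C ⊆ R, MeasurableSet C → ∀ᶠ n in atTop, c * m.real C ≤ m.real (C \ D n)) :
    ∀ᵐ ω ∂P, X ω ∩ Z = ∅ → ∃ᶠ n in atTop, X ω ∩ D n = ∅ := by
  classical
  have hemp : ∀ n, MeasurableSet {ω | X ω ∩ D n = ∅} := fun n => by
    simpa using hX.measurableSet_encard_eq (hD n) 0
  have hmain : ∀ K n₀ : ℕ, P {ω | X ω ∩ Z = ∅ ∧ (X ω ∩ R).encard ≤ K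
      ∧ ∀ n, n₀ ≤ n → X ω ∩ D n ≠ ∅} = 0 := by
    intro K n₀
    set G : Set Ω := {ω | X ω ∩ Z = ∅ ∧ (X ω ∩ R).encard ≤ K} with hG
    have hGm : MeasurableSet G := by
      have h1 : MeasurableSet {ω | X ω ∩ Z = ∅} := by
        simpa using hX.measurableSet_encard_eq hZ 0
      exact h1.inter (hX.measurable_count R hR (t := Iic (K : ℕ∞)) .of_discrete)
    set F : ℕ → Set Ω := fun M => {ω | ω ∈ G ∧ ∀ i < M, X ω ∩ D (n₀ + i) ≠ ∅} with hF
    have hFm : ∀ M, MeasurableSet (F M) := by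
      intro M
      have : F M = G ∩ ⋂ i : ℕ, ⋂ _ : i < M, {ω | X ω ∩ D (n₀ + i) = ∅}ᶜ := by
        ext ω; simp [hF]
      rw [this]
      exact hGm.inter (MeasurableSet.iInter fun i => MeasurableSet.iInter fun _ =>
        (hemp _).compl)
    have hFanti : Antitone F := fun M M' h ω hω => ⟨hω.1, fun i hi => hω.2 i (hi.trans_le h)⟩
    have hFinf : {ω | X ω ∩ Z = ∅ ∧ (X ω ∩ R).encard ≤ K ∧ ∀ n, n₀ ≤ n → X ω ∩ D n ≠ ∅}
        = ⋂ M, F M := by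
      ext ω
      simp only [hF, hG, mem_ofPred_eq, mem_iInter]
      constructor
      · rintro ⟨h1, h2, h3⟩ M
        exact ⟨⟨h1, h2⟩, fun i _ => h3 _ (Nat.le_add_right _ _)⟩
      · intro h
        refine ⟨(h 0).1.1, (h 0).1.2, fun n hn => ?_⟩
        have := (h (n - n₀ + 1)).2 (n - n₀) (Nat.lt_succ_self _)
        rwa [Nat.add_sub_cancel' hn] at this
    have htend : Tendsto (fun M => P.real (F M)) atTop (𝓝 (P.real (⋂ M, F M))) :=
      (ENNReal.tendsto_toReal (measure_ne_top _ _)).comp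
        (tendsto_measure_iInter_atTop (fun M => (hFm M).nullMeasurableSet) hFanti
          ⟨0, measure_ne_top _ _⟩)
    have hloss : ∀ M, c ^ K * P.real (F M) ≤ P.real (F M) - P.real (⋂ M, F M) := by
      intro M
      -- the atom of `S` consists of the points of `R` that lie in `D (n₀ + i)` exactly for `i ∈ S`
      set C : Option (Set (Fin M)) → Set E := fun o =>
        o.elim Z fun S => {x | x ∈ R ∧ ∀ i : Fin M, x ∈ D (n₀ + i) ↔ i ∈ S} with hCdef
      have hCR : ∀ S, C (some S) ⊆ R := fun S x hx => hx.1
      have hCm : ∀ o, MeasurableSet (C o) := by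
        rintro (_ | S)
        · exact hZ
        · refine hR.inter (?_ : MeasurableSet {x | ∀ i : Fin M, x ∈ D (n₀ + i) ↔ i ∈ S})
          rw [ofPred_forall]
          refine MeasurableSet.iInter fun i => ?_
          by_cases hi : i ∈ S
          · simp only [hi, iff_true]
            exact hD (n₀ + i)
          · simp only [hi, iff_false]
            exact (hD (n₀ + i)).compl
      have hCd : Pairwise (Function.onFun Disjoint C) := by
        rintro (_ | S) (_ | S') hne
        · exact absurd rfl hne
        · exact (hRZ.mono_left (hCR S')).symm
        · exact hRZ.mono_left (hCR S)
        · refine Set.disjoint_left.2 fun x hx hx' => hne ?_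
          congr 1
          ext i
          exact (hx.2 i).symm.trans (hx'.2 i)
      have hCfin : ∀ o, m (C o) ≠ ∞ := by
        rintro (_ | S)
        · exact hZm
        · exact measure_ne_top_of_subset (hCR S) hRm
      have hRU : R = ⋃ S, C (some S) := by
        ext x
        rw [mem_iUnion]
        exact ⟨fun hx => ⟨{i | x ∈ D (n₀ + i)}, hx, fun i => Iff.rfl⟩, fun ⟨S, hx⟩ => hx.1⟩
      have hsumR : ∀ ω, (X ω ∩ R).encard = ∑ S, (X ω ∩ C (some S)).encard := by
        intro ω
        rw [hRU, inter_iUnion, encard_iUnion_of_finite, finsum_eq_sum_of_fintype]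
        exact fun S S' hne => (hCd (Option.some_injective _ |>.ne hne)).mono
          inter_subset_right inter_subset_right
      set A : Set (Option (Set (Fin M)) → ℕ) := {k | k none = 0 ∧ ∑ S, k (some S) ≤ K ∧
        ∀ i : Fin M, ∃ S, i ∈ S ∧ k (some S) ≠ 0} with hA
      have hFA : F M = {ω | ∃ k ∈ A, ∀ o, (X ω ∩ C o).encard = k o} := by
        ext ω
        constructor
        · rintro ⟨⟨h1, h2⟩, h3⟩
          have hfin : ∀ o, (X ω ∩ C o).encard ≠ ⊤ := by
            rintro (_ | S)
            · change (X ω ∩ Z).encard ≠ ⊤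
              simp [h1]
            · have : (X ω ∩ C (some S)).encard ≤ K :=
                (encard_le_encard (inter_subset_inter_right _ (hCR S))).trans h2
              exact ne_top_of_le_ne_top (ENat.natCast_ne_top K) this
          refine ⟨fun o => (X ω ∩ C o).encard.toNat, ⟨?_, ?_, ?_⟩, fun o => ?_⟩
          · change (X ω ∩ Z).encard.toNat = 0
            simp [h1]
          · rw [hsumR] at h2
            have h4 : ∑ S, (X ω ∩ C (some S)).encard
                = ((∑ S, (X ω ∩ C (some S)).encard.toNat : ℕ) : ℕ∞) := by
              rw [Nat.cast_sum]
              exact Finset.sum_congr rfl fun S _ => (ENat.natCast_toNat (hfin _)).symm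
            rw [h4] at h2
            exact_mod_cast h2
          · intro i
            obtain ⟨x, hx, hxD⟩ := nonempty_iff_ne_empty.2 (h3 i i.2)
            have hxR : x ∈ R := by
              rcases hDRZ _ hxD with h | h
              · exact h
              · exact absurd (show x ∈ X ω ∩ Z from ⟨hx, h⟩) (by rw [h1]; exact fun h => h)
            refine ⟨{i | x ∈ D (n₀ + i)}, hxD, fun h0 => ?_⟩
            rw [ENat.toNat_eq_zero] at h0
            rcases h0 with h0 | h0
            · rw [encard_eq_zero] at h0
              have : x ∈ X ω ∩ C (some {i : Fin M | x ∈ D (n₀ + i)}) :=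
                ⟨hx, hxR, fun i => Iff.rfl⟩
              rw [h0] at this
              exact this
            · exact hfin _ h0
          · exact (ENat.natCast_toNat (hfin o)).symm
        · rintro ⟨k, ⟨hk1, hk2, hk3⟩, hk⟩
          refine ⟨⟨?_, ?_⟩, fun i hi h0 => ?_⟩
          · have := hk none
            rw [hk1] at this
            simpa [hCdef] using this
          · rw [hsumR]
            simp_rw [hk]
            exact_mod_cast hk2
          · obtain ⟨S, hS, hkS⟩ := hk3 ⟨i, hi⟩
            have h1 := hk (some S)
            have h2 : X ω ∩ C (some S) = ∅ := by
              refine subset_empty_iff.1 (h0 ▸ ?_)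
              exact fun x hx => ⟨hx.1, (hx.2.2 ⟨i, hi⟩).2 hS⟩
            rw [h2, encard_empty] at h1
            exact hkS (by exact_mod_cast h1.symm)
      obtain ⟨n, hn, hnM⟩ := ((eventually_all.2 fun S : Set (Fin M) =>
        hcD (C (some S)) (hCR S) (hCm _)).and (eventually_ge_atTop (n₀ + M))).exists
      have key := hX.pow_mul_real_iUnion_le hCm hCd hCfin (hD n) hc.le hc1 K A
        (fun k hk => by
          rw [Fintype.sum_option, hk.1, zero_add]
          exact hk.2.1)
        (by
          rintro k hk (_ | S) h0
          · exact absurd hk.1 h0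
          · exact hn S)
      rw [← hFA] at key
      have hsub : F M ∩ {ω | ∀ o, X ω ∩ (C o ∩ D n) = ∅} ⊆ F M \ ⋂ M, F M := by
        rintro ω ⟨h1, h2⟩
        refine ⟨h1, fun h3 => ?_⟩
        rw [← hFinf] at h3
        obtain ⟨x, hx, hxD⟩ := nonempty_iff_ne_empty.2
          (h3.2.2 n ((Nat.le_add_right _ _).trans hnM))
        rcases hDRZ _ hxD with h | h
        · rw [hRU, mem_iUnion] at h
          obtain ⟨S, hS⟩ := h
          have : x ∈ X ω ∩ (C (some S) ∩ D n) := ⟨hx, hS, hxD⟩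
          rw [h2 (some S)] at this
          exact this
        · have : x ∈ X ω ∩ Z := ⟨hx, h⟩
          rw [h3.1] at this
          exact this
      refine key.trans ((measureReal_mono hsub).trans_eq ?_)
      exact measureReal_sdiff (iInter_subset _ _) (MeasurableSet.iInter hFm)
    have hlim : c ^ K * P.real (⋂ M, F M) ≤ 0 := by
      have h1 := htend.const_mul (c ^ K)
      have h2 := htend.sub_const (P.real (⋂ M, F M))
      rw [sub_self] at h2
      exact le_of_tendsto_of_tendsto' h1 h2 hloss
    rw [hFinf]
    have : P.real (⋂ M, F M) = 0 :=
      le_antisymm (nonpos_of_mul_nonpos_right hlim (pow_pos hc K)) measureReal_nonneg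
    exact (measureReal_eq_zero_iff (measure_ne_top _ _)).1 this
  have hall : ∀ᵐ ω ∂P, ∀ K n₀ : ℕ, ¬ (X ω ∩ Z = ∅ ∧ (X ω ∩ R).encard ≤ K
      ∧ ∀ n, n₀ ≤ n → X ω ∩ D n ≠ ∅) := by
    refine ae_all_iff.2 fun K => ae_all_iff.2 fun n₀ => ?_
    rw [ae_iff]
    simpa only [not_not] using hmain K n₀
  filter_upwards [hall, hX.ae_finite_inter hR hRm] with ω hω hfin hZω
  rw [frequently_atTop]
  intro n₀
  by_contra! hne
  exact hω (X ω ∩ R).encard.toNat n₀ ⟨hZω,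
    (ENat.natCast_toNat hfin.encard_lt_top.ne).ge, fun n hn => nonempty_iff_ne_empty.1 (hne n hn)⟩

end IsPoissonPointProcess

end ScanLimit

/-! ### Detection events as points below a graph -/

open scoped symmDiff

namespace ScanLimit

variable {T : ℝ}

/-- The points of `[0, T] × ℝ` on or below the graph of `l`. -/
def subgraph (l : Icc (0 : ℝ) T → ℝ) : Set (Icc (0 : ℝ) T × ℝ) := {q | q.2 ≤ l q.1}

lemma measurableSet_subgraph {l : Icc (0 : ℝ) T → ℝ} (hl : Measurable l) :
    MeasurableSet (subgraph l) :=
  measurableSet_le measurable_snd (hl.comp measurable_fst)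

lemma stripVolume_symmDiff_subgraph {l l' : Icc (0 : ℝ) T → ℝ} (hl : Measurable l)
    (hl' : Measurable l') (h0 : ∀ s, 0 ≤ l s) (h0' : ∀ s, 0 ≤ l' s) :
    stripVolume T (subgraph l ∆ subgraph l') = eLpNorm (l - l') 1 (leb T) := by
  rw [stripVolume, Measure.prod_apply
    ((measurableSet_subgraph hl).symmDiff (measurableSet_subgraph hl')),
    eLpNorm_one_eq_lintegral_enorm]
  refine lintegral_congr fun s => ?_
  have : Prod.mk s ⁻¹' (subgraph l ∆ subgraph l') = Ioc (min (l s) (l' s)) (max (l s) (l' s)) := by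
    ext y
    simp only [subgraph, mem_preimage, Set.mem_symmDiff, mem_ofPred_eq, mem_Ioc, min_lt_iff,
      le_max_iff]
    grind
  rw [this, Measure.restrict_apply measurableSet_Ioc, inter_eq_left.2, Real.volume_Ioc,
    Pi.sub_apply, Real.enorm_eq_ofReal_abs, max_sub_min_eq_abs']
  exact fun y hy => (le_min (h0 s) (h0' s)).trans hy.1.le

lemma stripVolume_subgraph_ne_top {l : Icc (0 : ℝ) T → ℝ} (hl : Measurable l)
    (h0 : ∀ s, 0 ≤ l s) (hi : Integrable l (leb T)) : stripVolume T (subgraph l) ≠ ∞ := by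
  rw [stripVolume, Measure.prod_apply (measurableSet_subgraph hl)]
  have : ∀ s, (volume.restrict (Ici (0 : ℝ))) (Prod.mk s ⁻¹' subgraph l) = ‖l s‖ₑ := by
    intro s
    have : Prod.mk s ⁻¹' subgraph l = Iic (l s) := rfl
    rw [this, Measure.restrict_apply measurableSet_Iic, inter_comm, Ici_inter_Iic,
      Real.volume_Icc, Real.enorm_eq_ofReal_abs, abs_of_nonneg (h0 s), sub_zero]
  simp_rw [this]
  exact hi.2.ne

lemma measurableSet_graph {l : Icc (0 : ℝ) T → ℝ} (hl : Measurable l) :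
    MeasurableSet {q : Icc (0 : ℝ) T × ℝ | q.2 = l q.1} :=
  measurableSet_eq_fun measurable_snd (hl.comp measurable_fst)

lemma stripVolume_graph {l : Icc (0 : ℝ) T → ℝ} (hl : Measurable l) :
    stripVolume T {q | q.2 = l q.1} = 0 := by
  rw [stripVolume, Measure.prod_apply (measurableSet_graph hl)]
  refine (lintegral_congr fun s => ?_).trans lintegral_zero
  exact measure_singleton (μ := volume.restrict (Ici (0 : ℝ))) (l s)

lemma stripVolume_fst_preimage {S : Set (Icc (0 : ℝ) T)} (hS : leb T S = 0) :
    stripVolume T (Prod.fst ⁻¹' S) = 0 := by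
  rw [stripVolume, ← prod_univ, Measure.prod_prod, hS, zero_mul]

lemma stripVolume_snd_neg : stripVolume T {q | q.2 < 0} = 0 := by
  have : {q : Icc (0 : ℝ) T × ℝ | q.2 < 0} = univ ×ˢ Iio 0 := by ext; simp
  rw [this, stripVolume, Measure.prod_prod, Measure.restrict_apply measurableSet_Iio]
  have : Iio (0 : ℝ) ∩ Ici 0 = ∅ := by ext; simp
  rw [this, measure_empty, mul_zero]

/-- The number of detection events in `S` is the number of points of the support below the graph
of the intensity and above `S`. -/
lemma electronEvents_apply (e : CountingSpace T) (l : Icc (0 : ℝ) T → ℝ)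
    {S : Set (Icc (0 : ℝ) T)} (hS : MeasurableSet S) :
    electronEvents e l S = ((e.spt ∩ subgraph l ∩ Prod.fst ⁻¹' S).encard : ℝ≥0∞) := by
  rw [electronEvents, Measure.sum_apply _ hS]
  have h1 : ∀ q : {q : Icc (0 : ℝ) T × ℝ // q ∈ e.spt ∧ q.2 ≤ l q.1},
      Measure.dirac q.1.1 S = (Prod.fst ⁻¹' S : Set (Icc (0 : ℝ) T × ℝ)).indicator 1 q.1 := by
    intro q
    rw [Measure.dirac_apply' _ hS]
    rfl
  simp_rw [h1]
  have h2 := tsum_subtype {q : Icc (0 : ℝ) T × ℝ | q ∈ e.spt ∧ q.2 ≤ l q.1}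
    ((Prod.fst ⁻¹' S : Set (Icc (0 : ℝ) T × ℝ)).indicator (1 : Icc (0 : ℝ) T × ℝ → ℝ≥0∞))
  refine h2.trans ?_
  rw [indicator_indicator, ← tsum_subtype]
  exact ENNReal.tsum_set_one _

lemma electronEvents_univ (e : CountingSpace T) (l : Icc (0 : ℝ) T → ℝ) :
    electronEvents e l univ = ((e.spt ∩ subgraph l).encard : ℝ≥0∞) := by
  rw [electronEvents_apply e l MeasurableSet.univ, preimage_univ, inter_univ]

lemma isFiniteMeasure_electronEvents_iff {e : CountingSpace T} {l : Icc (0 : ℝ) T → ℝ} :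
    IsFiniteMeasure (electronEvents e l) ↔ (e.spt ∩ subgraph l).Finite := by
  rw [isFiniteMeasure_iff, electronEvents_univ, ← encard_lt_top_iff]
  simp

lemma electronEvents_congr {e : CountingSpace T} {l l' : Icc (0 : ℝ) T → ℝ}
    (h : e.spt ∩ (subgraph l ∆ subgraph l') = ∅) : electronEvents e l = electronEvents e l' := by
  have : e.spt ∩ subgraph l = e.spt ∩ subgraph l' := by
    rw [inter_symmDiff_distrib_left] at h
    exact symmDiff_eq_bot.1 h
  ext S hS
  rw [electronEvents_apply e l hS, electronEvents_apply e l' hS, this]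

/-- Without finiteness, the count is the junk value `0` of `Measure.real`. -/
lemma exists_nat_electronEvents_real (e : CountingSpace T) (l : Icc (0 : ℝ) T → ℝ)
    {S : Set (Icc (0 : ℝ) T)} (hS : MeasurableSet S) :
    ∃ k : ℕ, (electronEvents e l).real S = k := by
  rw [measureReal_def, electronEvents_apply e l hS]
  refine ⟨(e.spt ∩ subgraph l ∩ Prod.fst ⁻¹' S).encard.toNat, ?_⟩
  cases (e.spt ∩ subgraph l ∩ Prod.fst ⁻¹' S).encard <;> simp

/-- If `l ≤ l'` on `S` and there are equally many detection events in `S`, the points above `S`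
that are counted are the same. -/
lemma spt_inter_eq_of_electronEvents_eq {e : CountingSpace T} {l l' : Icc (0 : ℝ) T → ℝ}
    {S : Set (Icc (0 : ℝ) T)} (hS : MeasurableSet S) (hle : ∀ s ∈ S, l s ≤ l' s)
    [IsFiniteMeasure (electronEvents e l)] [IsFiniteMeasure (electronEvents e l')]
    (h : (electronEvents e l).real S = (electronEvents e l').real S) :
    e.spt ∩ subgraph l ∩ Prod.fst ⁻¹' S = e.spt ∩ subgraph l' ∩ Prod.fst ⁻¹' S := by
  have hfin : (e.spt ∩ subgraph l').Finite := isFiniteMeasure_electronEvents_iff.1 inferInstance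
  rw [measureReal_def, measureReal_def,
    ENNReal.toReal_eq_toReal_iff' (measure_ne_top _ _) (measure_ne_top _ _),
    electronEvents_apply e l hS, electronEvents_apply e l' hS] at h
  refine (hfin.subset inter_subset_left).eq_of_subset_of_encard_le' ?_ ?_
  · rintro q ⟨⟨h1, h2⟩, h3⟩
    exact ⟨⟨h1, le_trans (show q.2 ≤ l q.1 from h2) (hle _ h3)⟩, h3⟩
  · exact le_of_eq (by exact_mod_cast h.symm)

/-- Strong convergence of the detection events means that they are eventually constant: the total
variation is integer valued, and points with the same time coordinate do not cancel. -/
lemma StrongConv.eventually_inter_eq_empty {e : CountingSpace T} {l : ℕ → Icc (0 : ℝ) T → ℝ}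
    {l' : Icc (0 : ℝ) T → ℝ} (hl : ∀ n, Measurable (l n)) (hl' : Measurable l')
    (h : StrongConv (fun n => electronEvents e (l n)) (electronEvents e l')) :
    ∀ᶠ n in atTop, e.spt ∩ (subgraph (l n) ∆ subgraph l') = ∅ := by
  obtain ⟨hf, hf', ht⟩ := h
  filter_upwards [ht.eventually (gt_mem_nhds zero_lt_one)] with n hn
  have := hf n
  have heq : ∀ S, MeasurableSet S →
      (electronEvents e (l n)).real S = (electronEvents e l').real S := by
    intro S hS
    have h1 := (SignedMeasure.enorm_le_totalVariation
      ((electronEvents e (l n)).toSignedMeasure - (electronEvents e l').toSignedMeasure) S).trans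
      (measure_mono (subset_univ S))
    have h2 := h1.trans_lt hn
    rw [_root_.sub_apply, Measure.toSignedMeasure_apply_measurable hS,
      Measure.toSignedMeasure_apply_measurable hS] at h2
    obtain ⟨j, hj⟩ := exists_nat_electronEvents_real e (l n) hS
    obtain ⟨k, hk⟩ := exists_nat_electronEvents_real e l' hS
    rw [hj, hk, Real.enorm_eq_ofReal_abs, ENNReal.ofReal_lt_one] at h2
    rw [hj, hk]
    have h3 : |(j : ℤ) - k| < 1 := by exact_mod_cast h2
    have h4 := Int.abs_lt_one_iff.1 h3
    have h5 : (j : ℤ) = k := by linarith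
    exact_mod_cast h5
  have hS : MeasurableSet {s | l n s ≤ l' s} := measurableSet_le (hl n) hl'
  have e1 := spt_inter_eq_of_electronEvents_eq hS (fun s hs => hs) (heq _ hS)
  have e2 := spt_inter_eq_of_electronEvents_eq hS.compl
    (fun s hs => (not_le.1 (show ¬ l n s ≤ l' s from hs)).le) (heq _ hS.compl).symm
  have e3 : e.spt ∩ subgraph (l n) = e.spt ∩ subgraph l' := by
    rw [← inter_union_compl (e.spt ∩ subgraph (l n)) (Prod.fst ⁻¹' {s | l n s ≤ l' s}),
      ← inter_union_compl (e.spt ∩ subgraph l') (Prod.fst ⁻¹' {s | l n s ≤ l' s}), e1]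
    congr 1
    exact e2.symm
  rw [inter_symmDiff_distrib_left, e3]
  exact symmDiff_self _

lemma strongConv_of_eventually_eq {ν : ℕ → Measure (Icc (0 : ℝ) T)}
    {ν' : Measure (Icc (0 : ℝ) T)} (hf : ∀ n, IsFiniteMeasure (ν n)) (hf' : IsFiniteMeasure ν')
    (h : ∀ᶠ n in atTop, ν n = ν') : StrongConv ν ν' := by
  refine ⟨hf, hf', tendsto_const_nhds.congr' ?_⟩
  filter_upwards [h] with n hn
  have h1 := hf n
  have h2 : (ν n).toSignedMeasure = ν'.toSignedMeasure := by
    ext S hS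
    rw [Measure.toSignedMeasure_apply_measurable hS, Measure.toSignedMeasure_apply_measurable hS,
      hn]
  rw [h2, sub_self, tvNorm, SignedMeasure.totalVariation_zero]
  rfl

lemma ae_isFiniteMeasure_electronEvents {P : Measure (CountingSpace T)} [IsProbabilityMeasure P]
    (hP : IsPoissonPointProcess CountingSpace.spt (stripVolume T) P)
    {l : Icc (0 : ℝ) T → ℝ} (hl : Measurable l)
    (h0 : ∀ s, 0 ≤ l s) (hi : Integrable l (leb T)) :
    ∀ᵐ e ∂P, IsFiniteMeasure (electronEvents e l) := by
  filter_upwards [hP.ae_finite_inter (measurableSet_subgraph hl)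
    (stripVolume_subgraph_ne_top hl h0 hi)] with e he
  exact isFiniteMeasure_electronEvents_iff.2 he

/-- Almost surely there is no detection event at the end point `T`. -/
lemma ae_electronEvents_lt {P : Measure (CountingSpace T)} [IsProbabilityMeasure P]
    (hP : IsPoissonPointProcess CountingSpace.spt (stripVolume T) P)
    (l : Icc (0 : ℝ) T → ℝ) :
    ∀ᵐ e ∂P, ∀ᵐ s : Icc (0 : ℝ) T ∂(electronEvents e l), (s : ℝ) < T := by
  have hS : MeasurableSet {s : Icc (0 : ℝ) T | ¬ (s : ℝ) < T} :=
    (measurableSet_lt measurable_subtype_coe measurable_const).compl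
  have hS0 : leb T {s : Icc (0 : ℝ) T | ¬ (s : ℝ) < T} = 0 := by
    refine Set.Subsingleton.measure_zero (fun s hs s' hs' => Subtype.ext ?_) _
    exact (le_antisymm s.2.2 (not_lt.1 hs)).trans (le_antisymm s'.2.2 (not_lt.1 hs')).symm
  filter_upwards [hP.ae_inter_eq_empty (measurable_fst hS) (stripVolume_fst_preimage hS0)]
    with e he
  rw [ae_iff, electronEvents_apply e l hS, inter_right_comm, he, empty_inter, encard_empty]
  simp

/-- For uniformly convergent intensities the detection events are almost surely eventually
constant: only the finitely many points below the graph of `lamInf + 1` matter, and none of these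
lies on the graph of `lamInf`. -/
lemma ae_eventually_electronEvents_eq {P : Measure (CountingSpace T)} [IsProbabilityMeasure P]
    (hP : IsPoissonPointProcess CountingSpace.spt (stripVolume T) P)
    {lam : ℕ → Icc (0 : ℝ) T → ℝ}
    {lamInf : Icc (0 : ℝ) T → ℝ} (hlamInf0 : ∀ s, 0 ≤ lamInf s)
    (hlamInfM : Measurable lamInf) (hlamInfI : Integrable lamInf (leb T))
    (hu : TendstoUniformly lam lamInf atTop) :
    ∀ᵐ e ∂P, ∀ᶠ n in atTop, electronEvents e (lam n) = electronEvents e lamInf := by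
  filter_upwards [hP.ae_finite_inter (measurableSet_subgraph (hlamInfM.add_const 1))
    (stripVolume_subgraph_ne_top (hlamInfM.add_const 1) (fun s => by linarith [hlamInf0 s])
      (hlamInfI.add (integrable_const 1))),
    hP.ae_inter_eq_empty (measurableSet_graph hlamInfM) (stripVolume_graph hlamInfM)] with e hfin hgr
  rw [Metric.tendstoUniformly_iff] at hu
  have h1 : ∀ᶠ n in atTop, ∀ q ∈ e.spt ∩ subgraph (fun s => lamInf s + 1),
      dist (lamInf q.1) (lam n q.1) < |q.2 - lamInf q.1| := by
    rw [eventually_all_finite hfin]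
    intro q hq
    have hne : q.2 - lamInf q.1 ≠ 0 := by
      intro h
      have : q ∈ e.spt ∩ {q | q.2 = lamInf q.1} := ⟨hq.1, sub_eq_zero.1 h⟩
      rw [hgr] at this
      exact this
    filter_upwards [hu _ (abs_pos.2 hne)] with n hn using hn _
  filter_upwards [h1, hu 1 one_pos] with n hn1 hn2
  refine electronEvents_congr (eq_empty_of_forall_notMem ?_)
  rintro q ⟨hq, hq'⟩
  have h3 := hn2 q.1
  rw [Real.dist_eq, abs_lt] at h3
  have hmem : q.2 ≤ lamInf q.1 + 1 := by
    rcases hq' with ⟨h, -⟩ | ⟨h, -⟩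
    · have h' : q.2 ≤ lam n q.1 := h
      linarith
    · have h' : q.2 ≤ lamInf q.1 := h
      linarith
  have h4 := hn1 q ⟨hq, hmem⟩
  rw [Real.dist_eq] at h4
  rcases hq' with ⟨h, h'⟩ | ⟨h, h'⟩
  · have h5 : q.2 ≤ lam n q.1 := h
    have h6 : lamInf q.1 < q.2 := not_le.1 h'
    rw [abs_of_pos (sub_pos.2 h6)] at h4
    linarith [(abs_lt.1 h4).1]
  · have h5 : q.2 ≤ lamInf q.1 := h
    have h6 : lam n q.1 < q.2 := not_le.1 h'
    rw [abs_of_nonpos (sub_nonpos.2 h5)] at h4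
    linarith [(abs_lt.1 h4).2]

/-- Strong convergence forces the void probabilities `exp (-‖lam n - lamInf‖₁)` of the sets
between the graphs to converge to one. -/
lemma l1Conv_of_ae_strongConv {P : Measure (CountingSpace T)} [IsProbabilityMeasure P]
    (hP : IsPoissonPointProcess CountingSpace.spt (stripVolume T) P)
    {lam : ℕ → Icc (0 : ℝ) T → ℝ} {lamInf : Icc (0 : ℝ) T → ℝ}
    (hlam0 : ∀ n s, 0 ≤ lam n s) (hlamInf0 : ∀ s, 0 ≤ lamInf s)
    (hlamM : ∀ n, Measurable (lam n)) (hlamInfM : Measurable lamInf)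
    (hlamI : ∀ n, Integrable (lam n) (leb T)) (hlamInfI : Integrable lamInf (leb T))
    (h : ∀ᵐ e ∂P, StrongConv (fun n => electronEvents e (lam n)) (electronEvents e lamInf)) :
    L1Conv lam lamInf := by
  have hD : ∀ n, MeasurableSet (subgraph (lam n) ∆ subgraph lamInf) := fun n =>
    (measurableSet_subgraph (hlamM n)).symmDiff (measurableSet_subgraph hlamInfM)
  have hvol : ∀ n, stripVolume T (subgraph (lam n) ∆ subgraph lamInf)
      = eLpNorm (lam n - lamInf) 1 (leb T) := fun n =>
    stripVolume_symmDiff_subgraph (hlamM n) hlamInfM (hlam0 n) hlamInf0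
  have hfin : ∀ n, stripVolume T (subgraph (lam n) ∆ subgraph lamInf) ≠ ∞ := fun n => by
    rw [hvol]
    exact (memLp_one_iff_integrable.2 ((hlamI n).sub hlamInfI)).2.ne
  have hA : ∀ n, MeasurableSet {e : CountingSpace T |
      e.spt ∩ (subgraph (lam n) ∆ subgraph lamInf) = ∅} := fun n => by
    simpa using hP.measurableSet_encard_eq (hD n) 0
  have h1 := tendsto_measure_of_ae_tendsto_indicator_of_isFiniteMeasure (μ := P) atTop
    MeasurableSet.univ hA (by
      filter_upwards [h] with e he
      filter_upwards [he.eventually_inter_eq_empty hlamM hlamInfM] with n hn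
      simpa using hn)
  rw [measure_univ] at h1
  have h2 : Tendsto (fun n => Real.exp
      (-(stripVolume T).real (subgraph (lam n) ∆ subgraph lamInf))) atTop (𝓝 1) := by
    have := (ENNReal.tendsto_toReal ENNReal.one_ne_top).comp h1
    simp only [ENNReal.toReal_one] at this
    exact this.congr fun n => hP.real_inter_eq_empty (hD n) (hfin n)
  have h3 := (Real.continuousAt_log one_ne_zero).tendsto.comp h2
  simp only [Function.comp_def, Real.log_exp, Real.log_one] at h3
  have h4 := ENNReal.tendsto_ofReal h3.neg
  simp only [neg_neg, neg_zero, ENNReal.ofReal_zero] at h4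
  refine h4.congr fun n => ?_
  rw [ofReal_measureReal (hfin n), hvol]

end ScanLimit

/-! ### Weakly-* convergent intensities -/

namespace ScanLimit

variable {T : ℝ}

/-- Weakly-* convergent sequences in `L^∞` are bounded, by the Banach-Steinhaus theorem. -/
lemma LinftyWeakStarConv.exists_bound {lam : ℕ → Icc (0 : ℝ) T → ℝ} {lamInf : Icc (0 : ℝ) T → ℝ}
    (h : LinftyWeakStarConv lam lamInf) :
    ∃ M : ℝ, 0 < M ∧ (∀ n, ∀ᵐ s ∂(leb T), lam n s ≤ M) ∧ ∀ᵐ s ∂(leb T), lamInf s ≤ M := by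
  obtain ⟨hm, hm', hc⟩ := h
  set F : ℕ → Lp ℝ 1 (leb T) →L[ℝ] ℝ := fun n =>
    (ContinuousLinearMap.mul ℝ ℝ).lpPairing (leb T) ∞ 1 ((hm n).toLp (lam n)) with hF
  have hFapp : ∀ n (g : Lp ℝ 1 (leb T)), F n g = ∫ s, lam n s * g s ∂(leb T) := by
    intro n g
    rw [hF, ContinuousLinearMap.lpPairing_eq_integral]
    refine integral_congr_ae ?_
    filter_upwards [(hm n).coeFn_toLp] with s hs
    rw [hs, ContinuousLinearMap.mul_apply']
  obtain ⟨C, hC⟩ := banach_steinhaus (g := F) (fun g => by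
    obtain ⟨C, hC⟩ := (hc g (L1.integrable_coeFn g)).norm.bddAbove_range
    exact ⟨C, fun n => by rw [hFapp]; exact hC ⟨n, rfl⟩⟩)
  have hbound : ∀ n, ∀ᵐ s ∂(leb T), lam n s ≤ C := by
    intro n
    refine ae_le_of_forall_setIntegral_le ((hm n).integrable (by simp)) (integrable_const C)
      fun S hS _ => ?_
    have h1 : F n (indicatorConstLp 1 hS (measure_ne_top _ _) 1) = ∫ s in S, lam n s ∂(leb T) := by
      rw [hFapp, ← integral_indicator hS]
      refine integral_congr_ae ?_
      filter_upwards [indicatorConstLp_coeFn (p := 1) (hs := hS)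
        (hμs := measure_ne_top (leb T) S) (c := (1 : ℝ))] with s hs
      rw [hs]
      by_cases hsS : s ∈ S <;> simp [hsS]
    rw [← h1, setIntegral_const, smul_eq_mul, mul_comm]
    refine (le_abs_self _).trans (((F n).le_opNorm _).trans ?_)
    rw [norm_indicatorConstLp one_ne_zero ENNReal.one_ne_top]
    simp only [norm_one, ENNReal.toReal_one, div_one, Real.rpow_one, one_mul]
    exact mul_le_mul_of_nonneg_right (hC n) measureReal_nonneg
  have hbound' : ∀ᵐ s ∂(leb T), lamInf s ≤ (eLpNormEssSup lamInf (leb T)).toReal := by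
    filter_upwards [ae_le_eLpNormEssSup (f := lamInf) (μ := leb T)] with s hs
    have htop : eLpNormEssSup lamInf (leb T) ≠ ∞ := by
      rw [← eLpNorm_exponent_top]
      exact hm'.2.ne
    have := ENNReal.toReal_mono htop hs
    rw [toReal_enorm, Real.norm_eq_abs] at this
    exact (le_abs_self _).trans this
  refine ⟨max (max C (eLpNormEssSup lamInf (leb T)).toReal) 1,
    zero_lt_one.trans_le (le_max_right _ _), fun n => ?_, ?_⟩
  · filter_upwards [hbound n] with s hs
    exact hs.trans ((le_max_left _ _).trans (le_max_left _ _))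
  · filter_upwards [hbound'] with s hs
    exact hs.trans ((le_max_right _ _).trans (le_max_left _ _))

/-- If functions bounded below by `-M` are at least `ε` on `C ∩ D n` and have integrals over `C`
that tend to zero, then `D n` cannot occupy almost all of `C`. -/
lemma eventually_mul_real_le_of_tendsto_setIntegral {E : Type*} [MeasurableSpace E] {m : Measure E}
    {v : ℕ → E → ℝ} {C : Set E} {D : ℕ → Set E} (hC : MeasurableSet C) (hCm : m C ≠ ∞)
    (hD : ∀ n, MeasurableSet (D n)) (hv : ∀ n, IntegrableOn (v n) C m) {ε M : ℝ} (hε : 0 < ε)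
    (hM : 0 < M) (hlow : ∀ n, ∀ᵐ x ∂m, x ∈ C → -M ≤ v n x)
    (hbig : ∀ n, ∀ x ∈ C ∩ D n, ε ≤ v n x)
    (ht : Tendsto (fun n => ∫ x in C, v n x ∂m) atTop (𝓝 0)) :
    ∀ᶠ n in atTop, ε / (2 * (M + ε)) * m.real C ≤ m.real (C \ D n) := by
  rcases eq_or_lt_of_le (measureReal_nonneg (μ := m) (s := C)) with h0 | hpos
  · refine .of_forall fun n => ?_
    rw [← h0, mul_zero]
    exact measureReal_nonneg
  filter_upwards [ht.eventually (ge_mem_nhds (show 0 < ε * m.real C / 2 by positivity))] with n hn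
  have hsplit : m.real (C ∩ D n) + m.real (C \ D n) = m.real C :=
    measureReal_inter_add_sdiff (hD n) hCm
  have h1 : ε * m.real (C ∩ D n) ≤ ∫ x in C ∩ D n, v n x ∂m :=
    setIntegral_ge_of_const_le_real (hC.inter (hD n))
      (measure_ne_top_of_subset inter_subset_left hCm) (hbig n) ((hv n).mono_set inter_subset_left)
  have h2 : -M * m.real (C \ D n) ≤ ∫ x in C \ D n, v n x ∂m := by
    have hfin : m (C \ D n) ≠ ∞ := measure_ne_top_of_subset sdiff_subset hCm
    have := setIntegral_mono_on_ae (f := fun _ => -M) (g := v n) (μ := m)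
      (integrableOn_const hfin) ((hv n).mono_set sdiff_subset) (hC.diff (hD n))
      ((hlow n).mono fun x hx hxC => hx hxC.1)
    rwa [setIntegral_const, smul_eq_mul, mul_comm] at this
  have h3 : ∫ x in C ∩ D n, v n x ∂m + ∫ x in C \ D n, v n x ∂m = ∫ x in C, v n x ∂m :=
    integral_inter_add_sdiff (hD n) (hv n)
  rw [div_mul_eq_mul_div, div_le_iff₀ (by positivity)]
  nlinarith

lemma integrableOn_fst {u : Icc (0 : ℝ) T → ℝ} (hu : Integrable u (leb T)) {M : ℝ}
    {C : Set (Icc (0 : ℝ) T × ℝ)} (hC : C ⊆ univ ×ˢ Icc 0 M) :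
    IntegrableOn (fun q => u q.1) C (stripVolume T) := by
  refine IntegrableOn.mono_set ?_ hC
  rw [IntegrableOn, stripVolume, ← Measure.prod_restrict, Measure.restrict_univ]
  have : IsFiniteMeasure ((volume.restrict (Ici (0 : ℝ))).restrict (Icc 0 M)) :=
    ⟨by
      rw [Measure.restrict_apply_univ]
      exact (Measure.restrict_apply_le _ _).trans_lt (by simp)⟩
  exact hu.comp_fst _

lemma stripVolume_strip_ne_top (M : ℝ) : stripVolume T (univ ×ˢ Icc 0 M) ≠ ∞ := by
  rw [stripVolume, Measure.prod_prod]
  exact ENNReal.mul_ne_top (measure_ne_top _ _)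
    ((Measure.restrict_apply_le _ _).trans_lt (by simp)).ne

/-- Integrals over a set `C` of bounded height are integrals against the length of the sections
of `C`, so that weak-* convergence applies. -/
lemma LinftyWeakStarConv.tendsto_setIntegral {lam : ℕ → Icc (0 : ℝ) T → ℝ}
    {lamInf : Icc (0 : ℝ) T → ℝ} (h : LinftyWeakStarConv lam lamInf) {M : ℝ}
    {C : Set (Icc (0 : ℝ) T × ℝ)} (hCm : MeasurableSet C) (hC : C ⊆ univ ×ˢ Icc 0 M) :
    Tendsto (fun n => ∫ q in C, (lam n q.1 - lamInf q.1) ∂(stripVolume T)) atTop (𝓝 0) := by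
  obtain ⟨hm, hm', hc⟩ := h
  set w : Icc (0 : ℝ) T → ℝ := fun s => (volume.restrict (Ici (0 : ℝ))).real (Prod.mk s ⁻¹' C)
  have hsub : ∀ s, Prod.mk s ⁻¹' C ⊆ Icc 0 M := fun s y hy => (hC hy).2
  have hfin : (volume.restrict (Ici (0 : ℝ))) (Icc 0 M) ≠ ∞ :=
    ((Measure.restrict_apply_le _ _).trans_lt (by simp)).ne
  have hw : Integrable w (leb T) := by
    refine Integrable.of_bound ?_ ((volume.restrict (Ici (0 : ℝ))).real (Icc 0 M))
      (ae_of_all _ fun s => ?_)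
    · exact (measurable_measure_prodMk_left hCm).ennreal_toReal.aestronglyMeasurable
    · rw [Real.norm_of_nonneg measureReal_nonneg]
      exact measureReal_mono (hsub s) hfin
  have hint : ∀ u : Icc (0 : ℝ) T → ℝ, Integrable u (leb T) →
      ∫ q in C, u q.1 ∂(stripVolume T) = ∫ s, u s * w s ∂(leb T) := by
    intro u hu
    rw [← integral_indicator hCm, stripVolume, integral_prod _
      ((integrable_indicator_iff hCm).2 (integrableOn_fst hu hC))]
    refine integral_congr_ae (ae_of_all _ fun s => ?_)
    have : (fun y => C.indicator (fun q : Icc (0 : ℝ) T × ℝ => u q.1) (s, y))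
        = (Prod.mk s ⁻¹' C).indicator fun _ => u s := by
      ext y
      by_cases hy : (s, y) ∈ C <;> simp [hy]
    simp only [this]
    rw [integral_indicator_const _ (measurable_prodMk_left hCm), smul_eq_mul, mul_comm]
  have hi : ∀ n, Integrable (lam n) (leb T) := fun n => (hm n).integrable (by simp)
  have hi' : Integrable lamInf (leb T) := hm'.integrable (by simp)
  have key := (hc w hw).sub_const (∫ s, lamInf s * w s ∂(leb T))
  rw [sub_self] at key
  refine key.congr fun n => ?_
  rw [← hint _ (hi n), ← hint _ hi', integral_sub (integrableOn_fst (hi n) hC)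
    (integrableOn_fst hi' hC)]

/-- Under weak-* convergence, the sets between the graphs of `lam n` and `lamInf` leave free a
fixed proportion of each set `C` at a positive vertical distance from the graph of `lamInf`. -/
lemma LinftyWeakStarConv.eventually_mul_real_le {lam : ℕ → Icc (0 : ℝ) T → ℝ}
    {lamInf : Icc (0 : ℝ) T → ℝ} (h : LinftyWeakStarConv lam lamInf)
    (hlam0 : ∀ n s, 0 ≤ lam n s) (hlamInf0 : ∀ s, 0 ≤ lamInf s)
    (hlamM : ∀ n, Measurable (lam n)) (hlamInfM : Measurable lamInf) {M ε : ℝ} (hM : 0 < M)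
    (hε : 0 < ε) (hb : ∀ n, ∀ᵐ s ∂(leb T), lam n s ≤ M) (hb' : ∀ᵐ s ∂(leb T), lamInf s ≤ M)
    {C : Set (Icc (0 : ℝ) T × ℝ)} (hCm : MeasurableSet C) (hC : C ⊆ univ ×ˢ Icc 0 M)
    (hCε : ∀ q ∈ C, ε ≤ |q.2 - lamInf q.1|) :
    ∀ᶠ n in atTop, ε / (2 * (M + ε)) * (stripVolume T).real C
      ≤ (stripVolume T).real (C \ (subgraph (lam n) ∆ subgraph lamInf)) := by
  have hD : ∀ n, MeasurableSet (subgraph (lam n) ∆ subgraph lamInf) := fun n =>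
    (measurableSet_subgraph (hlamM n)).symmDiff (measurableSet_subgraph hlamInfM)
  have hi : ∀ n, Integrable (lam n) (leb T) := fun n => (h.1 n).integrable (by simp)
  have hi' : Integrable lamInf (leb T) := h.2.1.integrable (by simp)
  have hS : MeasurableSet (subgraph lamInf) := measurableSet_subgraph hlamInfM
  have hfin : ∀ C' ⊆ C, stripVolume T C' ≠ ∞ := fun C' hC' =>
    measure_ne_top_of_subset (hC'.trans hC) (stripVolume_strip_ne_top M)
  have hae : ∀ {p : Icc (0 : ℝ) T → Prop}, (∀ᵐ s ∂(leb T), p s) →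
      ∀ᵐ q ∂(stripVolume T), p q.1 := fun {p} hp => stripVolume_fst_preimage (S := {s | ¬ p s}) hp
  have habove := eventually_mul_real_le_of_tendsto_setIntegral (m := stripVolume T)
    (C := C \ subgraph lamInf) (D := fun n => subgraph (lam n) ∆ subgraph lamInf)
    (v := fun n q => lam n q.1 - lamInf q.1) (hCm.diff hS) (hfin _ sdiff_subset) hD
    (fun n => integrableOn_fst ((hi n).sub hi') (sdiff_subset.trans hC)) hε hM
    (fun n => by
      filter_upwards [hae hb'] with q hq _
      linarith [hlam0 n q.1])
    (by
      rintro n q ⟨⟨hq, hq'⟩, hqD⟩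
      have h1 : lamInf q.1 < q.2 := not_le.1 hq'
      have h2 : q.2 ≤ lam n q.1 := by
        rcases hqD with ⟨h, -⟩ | ⟨h, -⟩
        · exact h
        · exact absurd h hq'
      have h3 := hCε q hq
      rw [abs_of_pos (sub_pos.2 h1)] at h3
      linarith)
    (h.tendsto_setIntegral (hCm.diff hS) (sdiff_subset.trans hC))
  have hbelow := eventually_mul_real_le_of_tendsto_setIntegral (m := stripVolume T)
    (C := C ∩ subgraph lamInf) (D := fun n => subgraph (lam n) ∆ subgraph lamInf)
    (v := fun n q => -(lam n q.1 - lamInf q.1)) (hCm.inter hS) (hfin _ inter_subset_left) hD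
    (fun n => (integrableOn_fst ((hi n).sub hi') (inter_subset_left.trans hC)).neg) hε hM
    (fun n => by
      filter_upwards [hae (hb n)] with q hq _
      linarith [hlamInf0 q.1])
    (by
      rintro n q ⟨⟨hq, hq'⟩, hqD⟩
      have h1 : q.2 ≤ lamInf q.1 := hq'
      have h2 : lam n q.1 < q.2 := by
        rcases hqD with ⟨-, h⟩ | ⟨-, h⟩
        · exact absurd hq' h
        · exact not_le.1 h
      have h3 := hCε q hq
      rw [abs_of_nonpos (sub_nonpos.2 h1)] at h3
      linarith)
    (by
      have := (h.tendsto_setIntegral (hCm.inter hS) (inter_subset_left.trans hC)).neg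
      simp only [neg_zero] at this
      exact this.congr fun n => (integral_neg _).symm)
  filter_upwards [habove, hbelow] with n h1 h2
  rw [← measureReal_inter_add_sdiff (s := C) hS (hfin C subset_rfl),
    ← measureReal_inter_add_sdiff (s := C \ (subgraph (lam n) ∆ subgraph lamInf)) hS
      (hfin _ sdiff_subset), mul_add, sdiff_inter_right_comm, sdiff_sdiff_comm]
  exact add_le_add h2 h1

/-- For weakly-* convergent intensities, the detection events almost surely agree infinitely often
with those of the limit. The set near the graph of `lamInf` where `ae_frequently_inter_eq_empty`
gives no information can be taken arbitrarily thin, and thus free of points. -/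
lemma ae_frequently_electronEvents_eq {P : Measure (CountingSpace T)} [IsProbabilityMeasure P]
    (hP : IsPoissonPointProcess CountingSpace.spt (stripVolume T) P)
    {lam : ℕ → Icc (0 : ℝ) T → ℝ} {lamInf : Icc (0 : ℝ) T → ℝ}
    (hlam0 : ∀ n s, 0 ≤ lam n s) (hlamInf0 : ∀ s, 0 ≤ lamInf s)
    (hlamM : ∀ n, Measurable (lam n)) (hlamInfM : Measurable lamInf)
    (h : LinftyWeakStarConv lam lamInf) :
    ∀ᵐ e ∂P, ∃ᶠ n in atTop, electronEvents e (lam n) = electronEvents e lamInf := by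
  obtain ⟨M, hM, hb, hb'⟩ := h.exists_bound
  set U : Set (Icc (0 : ℝ) T × ℝ) := univ ×ˢ Icc 0 M with hU
  have hUm : MeasurableSet U := MeasurableSet.univ.prod measurableSet_Icc
  set D : ℕ → Set (Icc (0 : ℝ) T × ℝ) := fun n => subgraph (lam n) ∆ subgraph lamInf with hDdef
  have hD : ∀ n, MeasurableSet (D n) := fun n =>
    (measurableSet_subgraph (hlamM n)).symmDiff (measurableSet_subgraph hlamInfM)
  have hdist : Measurable fun q : Icc (0 : ℝ) T × ℝ => |q.2 - lamInf q.1| :=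
    (measurable_snd.sub (hlamInfM.comp measurable_fst)).abs
  have hnear : ∀ j : ℕ, ∀ᵐ e ∂P,
      e.spt ∩ (U ∩ {q | |q.2 - lamInf q.1| < 1 / ((j : ℝ) + 1)}) = ∅ →
        ∃ᶠ n in atTop, e.spt ∩ (D n ∩ U) = ∅ := by
    intro j
    have hε : (0 : ℝ) < 1 / ((j : ℝ) + 1) := by positivity
    have hfar : MeasurableSet {q : Icc (0 : ℝ) T × ℝ | 1 / ((j : ℝ) + 1) ≤ |q.2 - lamInf q.1|} :=
      measurableSet_le measurable_const hdist
    refine hP.ae_frequently_inter_eq_empty (fun n => (hD n).inter hUm)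
      (R := U ∩ {q | 1 / ((j : ℝ) + 1) ≤ |q.2 - lamInf q.1|}) (hUm.inter hfar)
      (hUm.inter (measurableSet_lt hdist measurable_const)) ?_
      (measure_ne_top_of_subset inter_subset_left (stripVolume_strip_ne_top M))
      (measure_ne_top_of_subset inter_subset_left (stripVolume_strip_ne_top M)) ?_
      (c := 1 / ((j : ℝ) + 1) / (2 * (M + 1 / ((j : ℝ) + 1)))) (by positivity) ?_ ?_
    · exact Set.disjoint_left.2 fun q hq hq' =>
        (show ¬ |q.2 - lamInf q.1| < 1 / ((j : ℝ) + 1) from not_lt.2 hq.2) hq'.2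
    · rintro n q ⟨-, hq⟩
      rcases le_or_gt (1 / ((j : ℝ) + 1)) |q.2 - lamInf q.1| with h1 | h1
      · exact Or.inl ⟨hq, h1⟩
      · exact Or.inr ⟨hq, h1⟩
    · rw [div_le_one (by positivity)]
      linarith
    · intro C hC hCm
      filter_upwards [h.eventually_mul_real_le hlam0 hlamInf0 hlamM hlamInfM hM hε hb hb' hCm
        (hC.trans inter_subset_left) fun q hq => (hC hq).2] with n hn
      have : C \ (D n ∩ U) = C \ D n := by
        rw [sdiff_inter, sdiff_eq_empty.2 (hC.trans inter_subset_left), union_empty]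
      rwa [this]
  have hhigh : ∀ {l : Icc (0 : ℝ) T → ℝ}, Measurable l → (∀ᵐ s ∂(leb T), l s ≤ M) →
      ∀ᵐ e ∂P, e.spt ∩ Prod.fst ⁻¹' {s | ¬ l s ≤ M} = ∅ := fun {l} hl hlb =>
    hP.ae_inter_eq_empty (measurable_fst (measurableSet_le hl measurable_const).compl)
      (stripVolume_fst_preimage hlb)
  filter_upwards [ae_all_iff.2 hnear, hP.ae_finite_inter hUm (stripVolume_strip_ne_top M),
    hP.ae_inter_eq_empty (measurableSet_graph hlamInfM) (stripVolume_graph hlamInfM),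
    hP.ae_inter_eq_empty (measurableSet_lt measurable_snd measurable_const) stripVolume_snd_neg,
    ae_all_iff.2 fun n => hhigh (hlamM n) (hb n), hhigh hlamInfM hb'] with e h1 h2 h3 h4 h5 h6
  obtain ⟨j, hj⟩ : ∃ j : ℕ, ∀ q ∈ e.spt ∩ U, 1 / ((j : ℝ) + 1) < |q.2 - lamInf q.1| := by
    refine ((eventually_all_finite h2).2 fun q hq => ?_ :
      ∀ᶠ j : ℕ in atTop, ∀ q ∈ e.spt ∩ U, 1 / ((j : ℝ) + 1) < |q.2 - lamInf q.1|).exists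
    refine (tendsto_one_div_add_atTop_nhds_zero_nat (𝕜 := ℝ)).eventually
      (gt_mem_nhds (abs_pos.2 fun h0 => ?_))
    exact (h3 ▸ (show q ∈ e.spt ∩ {q | q.2 = lamInf q.1} from ⟨hq.1, sub_eq_zero.1 h0⟩) :
      q ∈ (∅ : Set (Icc (0 : ℝ) T × ℝ)))
  refine (h1 j (eq_empty_of_forall_notMem ?_)).mono fun n hn => electronEvents_congr ?_
  · rintro q ⟨hq, hqU, hq'⟩
    exact absurd (hj q ⟨hq, hqU⟩) (not_lt.2 (le_of_lt hq'))
  · refine eq_empty_of_forall_notMem ?_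
    rintro q ⟨hq, hqD⟩
    have a1 : lam n q.1 ≤ M := by
      by_contra h0
      exact (h5 n ▸ (show q ∈ e.spt ∩ Prod.fst ⁻¹' {s | ¬ lam n s ≤ M} from ⟨hq, h0⟩) :
        q ∈ (∅ : Set (Icc (0 : ℝ) T × ℝ)))
    have a2 : lamInf q.1 ≤ M := by
      by_contra h0
      exact (h6 ▸ (show q ∈ e.spt ∩ Prod.fst ⁻¹' {s | ¬ lamInf s ≤ M} from ⟨hq, h0⟩) :
        q ∈ (∅ : Set (Icc (0 : ℝ) T × ℝ)))
    have a3 : 0 ≤ q.2 := by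
      by_contra h0
      exact (h4 ▸ (show q ∈ e.spt ∩ {q | q.2 < 0} from ⟨hq, not_le.1 h0⟩) :
        q ∈ (∅ : Set (Icc (0 : ℝ) T × ℝ)))
    have a4 : q.2 ≤ M := by
      rcases hqD with ⟨h0, -⟩ | ⟨h0, -⟩
      · exact le_trans h0 a1
      · exact le_trans h0 a2
    exact (hn ▸ (show q ∈ e.spt ∩ (D n ∩ U) from ⟨hq, hqD, mem_univ _, a3, a4⟩) :
      q ∈ (∅ : Set (Icc (0 : ℝ) T × ℝ)))

end ScanLimit

/-! ### Convergence of the measurements -/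

namespace ScanLimit

variable {T : ℝ}

/-- If the detection events along the subsequence `k` agree with `ε` and the noise vanishes
weakly-* in the limit, then the measurements converge weakly-* to `ε`. -/
lemma weakStarConvTo_measSignal {α μ : ℝ} (hα : 0 < α) {p : ℕ → TimePartition T}
    (hmesh : Tendsto (fun n => (p n).mesh) atTop (𝓝 0)) {σ : ℕ → ℝ}
    {ν : ℕ → Measure (Icc (0 : ℝ) T)} {ε : Measure (Icc (0 : ℝ) T)} {r : Icc (0 : ℝ) T → ℝ}
    (hε : IsFiniteMeasure ε) (hT : ∀ᵐ s : Icc (0 : ℝ) T ∂ε, (s : ℝ) < T)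
    (hr : WeakStarConv (fun n => densityMeasure ((p n).noiseSignal α μ (σ n) r)) 0)
    {k : ℕ → ℕ} (hk : Tendsto k atTop atTop) (hν : ∀ᶠ j in atTop, ν (k j) = ε) :
    WeakStarConvTo
      (fun j => densityMeasure ((p (k j)).measSignal α μ (σ (k j)) (ν (k j)) r)) ε := by
  refine ⟨hε, fun φ => ?_⟩
  have h1 := ((tendsto_sum_cellMean hmesh hT φ).add (hr φ)).comp hk
  rw [VectorMeasure.integral_zero_vectorMeasure, add_zero] at h1
  rw [VectorMeasure.integral_toSignedMeasure]
  refine h1.congr' ?_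
  filter_upwards [hν] with j hj
  rw [TimePartition.integral_measSignal _ hα, hj]
  rfl

end ScanLimit

theorem lemma2 (T : ℝ) (hT : 0 < T) (α : ℝ) (hα : 0 < α) (μ : ℝ)
    -- the law of the Poisson point process with intensity `1` on `[0, T] × [0, ∞)`
    (P : Measure (CountingSpace T)) [IsProbabilityMeasure P]
    (hP : IsPoissonPointProcess CountingSpace.spt (stripVolume T) P)
    -- the intensities
    (lam : ℕ → Icc (0 : ℝ) T → ℝ) (lamInf : Icc (0 : ℝ) T → ℝ)
    (hlam0 : ∀ n s, 0 ≤ lam n s) (hlamInf0 : ∀ s, 0 ≤ lamInf s)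
    (hlamM : ∀ n, Measurable (lam n)) (hlamInfM : Measurable lamInf)
    (hlamI : ∀ n, Integrable (lam n) (leb T)) (hlamInfI : Integrable lamInf (leb T))
    -- the time partitions, of increasing resolution
    (p : ℕ → TimePartition T) (hpN : StrictMono fun n => (p n).N)
    (hmesh : Tendsto (fun n => (p n).mesh) atTop (𝓝 0))
    -- the standard deviations of the background noise
    (σ : ℕ → ℝ) (hσ : ∀ n, 0 ≤ σ n) :
    -- 1. strong convergence of the electron events for uniformly convergent intensities
    (TendstoUniformly lam lamInf atTop →
      ∀ᵐ e ∂P, StrongConv (fun n => electronEvents e (lam n)) (electronEvents e lamInf)) ∧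
    -- 2. strong convergence of a subsequence for weakly-* convergent intensities
    (LinftyWeakStarConv lam lamInf →
      ∀ᵐ e ∂P, ∃ k : ℕ → ℕ, StrictMono k ∧
        StrongConv (fun j => electronEvents e (lam (k j))) (electronEvents e lamInf)) ∧
    (¬ L1Conv lam lamInf →
      0 < P {e | ¬ StrongConv (fun n => electronEvents e (lam n)) (electronEvents e lamInf)}) ∧
    -- 3. the background noise
    (Tendsto (fun n => σ n * (p n).N / α) atTop (𝓝 0) →
      ∀ᵐ r ∂(whiteNoise T),
        Tendsto (fun n => tvNorm (densityMeasure ((p n).noiseSignal α μ (σ n) r)))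
          atTop (𝓝 0)) ∧
    (Tendsto (fun n => σ n * (p n).N / α) atTop atTop →
      ∀ᵐ r ∂(whiteNoise T),
        Tendsto (fun n => tvNorm (densityMeasure ((p n).noiseSignal α μ (σ n) r)))
          atTop (𝓝 ∞)) ∧
    (∀ c : ℝ, 0 < c → Tendsto (fun n => σ n * (p n).N / α) atTop (𝓝 c) →
      ∀ᵐ r ∂(whiteNoise T),
        WeakStarConv (fun n => densityMeasure ((p n).noiseSignal α μ (σ n) r)) 0) ∧
    -- 4. the full measurement
    (∀ c : ℝ, Tendsto (fun n => σ n * (p n).N / α) atTop (𝓝 c) →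
      TendstoUniformly lam lamInf atTop →
      ∀ᵐ x ∂(P.prod (whiteNoise T)),
        WeakStarConvTo
          (fun n => densityMeasure
            ((p n).measSignal α μ (σ n) (electronEvents x.1 (lam n)) x.2))
          (electronEvents x.1 lamInf)) ∧
    (∀ c : ℝ, Tendsto (fun n => σ n * (p n).N / α) atTop (𝓝 c) →
      LinftyWeakStarConv lam lamInf →
      ∀ᵐ x ∂(P.prod (whiteNoise T)), ∃ k : ℕ → ℕ, StrictMono k ∧
        WeakStarConvTo
          (fun j => densityMeasure
            ((p (k j)).measSignal α μ (σ (k j)) (electronEvents x.1 (lam (k j))) x.2))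
          (electronEvents x.1 lamInf)) ∧
    -- 5. asymptotically integer-valued measurements
    (Tendsto (fun n => σ n * (p n).N / α) atTop (𝓝 0) →
      ∀ᵐ x ∂(P.prod (whiteNoise T)),
        Tendsto (fun n => tvNorm (densityMeasure ((p n).roundingDefect
          ((p n).measSignal α μ (σ n) (electronEvents x.1 (lam n)) x.2)))) atTop (𝓝 0)) := by
  have hf : ∀ᵐ e ∂P, (∀ n, IsFiniteMeasure (electronEvents e (lam n))) ∧
      IsFiniteMeasure (electronEvents e lamInf) :=
    (ae_all_iff.2 fun n => ae_isFiniteMeasure_electronEvents hP (hlamM n) (hlam0 n) (hlamI n)).and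
      (ae_isFiniteMeasure_electronEvents hP hlamInfM hlamInf0 hlamInfI)
  have hfst : ∀ {q : CountingSpace T → Prop}, (∀ᵐ e ∂P, q e) →
      ∀ᵐ x ∂(P.prod (whiteNoise T)), q x.1 := fun hq =>
    Measure.quasiMeasurePreserving_fst.ae hq
  have hsnd : ∀ {q : (Icc (0 : ℝ) T → ℝ) → Prop}, (∀ᵐ r ∂(whiteNoise T), q r) →
      ∀ᵐ x ∂(P.prod (whiteNoise T)), q x.2 := fun hq =>
    Measure.quasiMeasurePreserving_snd.ae hq
  refine ⟨fun hu => ?_, fun hw => ?_, fun hL => ?_, fun h0 => ?_, fun h0 => ?_,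
    fun c _ hc => ae_weakStarConv_noise hα hpN hσ hc, fun c hc hu => ?_, fun c hc hw => ?_,
    fun h0 => ?_⟩
  · filter_upwards [hf, ae_eventually_electronEvents_eq hP hlamInf0 hlamInfM hlamInfI hu]
      with e he1 he2
    exact strongConv_of_eventually_eq he1.1 he1.2 he2
  · filter_upwards [hf, ae_frequently_electronEvents_eq hP hlam0 hlamInf0 hlamM hlamInfM hw]
      with e he1 he2
    obtain ⟨k, hk, hk'⟩ := extraction_of_frequently_atTop he2
    exact ⟨k, hk, strongConv_of_eventually_eq (fun j => he1.1 (k j)) he1.2 (.of_forall hk')⟩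
  · refine pos_iff_ne_zero.2 fun h => hL ?_
    exact l1Conv_of_ae_strongConv hP hlam0 hlamInf0 hlamM hlamInfM hlamI hlamInfI h
  · filter_upwards [ae_tendsto_noise_zero hα hpN hσ h0] with r hr
    exact hr.congr fun n => ((p n).tvNorm_noiseSignal hα (hσ n) r).symm
  · filter_upwards [ae_tendsto_noise_top hα hpN hσ h0] with r hr
    exact hr.congr fun n => ((p n).tvNorm_noiseSignal hα (hσ n) r).symm
  · filter_upwards [hfst hf, hfst (ae_electronEvents_lt hP lamInf),
      hfst (ae_eventually_electronEvents_eq hP hlamInf0 hlamInfM hlamInfI hu),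
      hsnd (ae_weakStarConv_noise (μ := μ) hα hpN hσ hc)] with x h1 h2 h3 h4
    exact weakStarConvTo_measSignal (ν := fun n => electronEvents x.1 (lam n)) hα hmesh h1.2 h2 h4
      tendsto_id h3
  · filter_upwards [hfst hf, hfst (ae_electronEvents_lt hP lamInf),
      hfst (ae_frequently_electronEvents_eq hP hlam0 hlamInf0 hlamM hlamInfM hw),
      hsnd (ae_weakStarConv_noise (μ := μ) hα hpN hσ hc)] with x h1 h2 h3 h4
    obtain ⟨k, hk, hk'⟩ := extraction_of_frequently_atTop h3
    exact ⟨k, hk, weakStarConvTo_measSignal (ν := fun n => electronEvents x.1 (lam n)) hα hmesh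
      h1.2 h2 h4 hk.tendsto_atTop (.of_forall hk')⟩
  · filter_upwards [hsnd (ae_tendsto_noise_zero hα hpN hσ h0)] with x hx
    refine tendsto_of_tendsto_of_tendsto_of_le_of_le tendsto_const_nhds hx
      (fun n => zero_le) fun n => ?_
    exact (p n).tvNorm_roundingDefect_le hα (hσ n)
      (fun i => exists_nat_electronEvents_real x.1 (lam n) ((p n).measurableSet_cell i)) x.2
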